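/- **Conventions.** The exterior derivative is normalized as usual in contact metric geometry: for a $1$-form $\alpha$, $d\alpha(X,Y)=\tfrac12\big(X\alpha(Y)-Y\alpha(X)-\alpha([X,Y])\big)$ (and with the factor $\tfrac1{k+1}$ on $k$-forms). A *metric contact structure* on a smooth manifold $M$ of dimension $2n+1$ consists of a smooth contact form $\eta$ with its Reeb vector field $\xi$ (so $\eta(\xi)=1$ and $\xi\rfloor d\eta=0$), a smooth section $\Phi$ of $\operatorname{End}TM$ and a Riemannian metric $g_M$ such that $$\Phi^2=-\mathrm{Id}+\xi\otimes\eta,\qquad g_M(X,Y)=d\eta(X,\Phi Y)+\eta(X)\eta(Y),\qquad g_M(\Phi X,\Phi Y)=g_M(X,Y)-\eta(X)\eta(Y).$$ It is *K-contact* if $\xi$ is a Killing vector field of $g_M$, i.e. $\mathcal L_\xi g_M=0$. The cone is $C(M)=M\times\mathbb R^+$ with coordinate $r$ on $\mathbb R^+$. Let $\Psi=r\,\partial/\partial r$, regard $\xi$ as a vector field on $C(M)$, and let $I$ be the section of $\operatorname{End}TC(M)$ given by $I=\Phi$ on $\ker\eta\subset TM$, $I\xi=-\Psi$, $I\Psi=\xi$.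 The cone $(C(M),\omega,g)$, where $\omega=d(r^2\eta)$ and $g=dr^2+r^2g_M$, is *almost Kähler* (with $I$) if $\omega$ is a symplectic form, $g$ is a Riemannian metric, $I$ is an almost complex structure, and $g(X,Y)=\omega(X,IY)$. A complex vector field $Z$ on $C(M)$ is *pseudo-holomorphic* if it is an infinitesimal automorphism of $I$: $\mathcal L_ZI=0$, i.e. $[Z,IW]=I[Z,W]$ for all smooth complex vector fields $W$, where the bracket and $I$ are extended complex (bi)linearly. **Proposition 6.3.** Let $M$ be a compact smooth manifold of dimension $2n+1$ with a metric contact structure $(\eta,\xi,\Phi,g_M)$. Then $(M,\eta,g_M)$ is K-contact if and only if $(C(M),d(r^2\eta),dr^2+r^2g_M)$ is almost Kähler with $\Psi-i\xi$ pseudo-holomorphic. -/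

import Mathlib

open scoped Manifold ContDiff Topology
open Bundle Set

namespace AlmostKahlerCone

noncomputable section

/-! ### Tensor fields on a manifold `M` modelled on `(E, H)` through `I` -/

section Tensors

variable {E : Type*} [NormedAddCommGroup E] [NormedSpace ℝ E]
  {H : Type*} [TopologicalSpace H] (I : ModelWithCorners ℝ E H)
  (M : Type*) [TopologicalSpace M] [ChartedSpace H M]

/-- A (not necessarily smooth) vector field. -/
abbrev VField : Type _ := Π x : M, TangentSpace I x

/-- A (not necessarily smooth) field of covectors, i.e. a `1`-form. -/
abbrev CovField : Type _ := Π x : M, TangentSpace I x →L[ℝ] ℝ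

/-- A (not necessarily smooth) field of endomorphisms, i.e. a section of `End TM`. -/
abbrev EndField : Type _ := Π x : M, TangentSpace I x →L[ℝ] TangentSpace I x

/-- A (not necessarily smooth) field of bilinear forms. -/
abbrev BilinField : Type _ := Π x : M, TangentSpace I x →L[ℝ] TangentSpace I x →L[ℝ] ℝ

/-- A (not necessarily smooth) differential `k`-form. -/
abbrev DiffForm (k : ℕ) : Type _ := Π x : M, TangentSpace I x [⋀^Fin k]→L[ℝ] ℝ

variable {M} [IsManifold I ∞ M]

/-- Smoothness of a vector field, as a section of the tangent bundle. -/
def IsSmoothVField (X : VField I M) : Prop :=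
  ContMDiff I I.tangent ∞ (fun x ↦ (TotalSpace.mk' E x (X x) : TangentBundle I M))

/-- Smoothness of a `1`-form, as a section of the cotangent bundle. -/
def IsSmoothCovField (α : CovField I M) : Prop :=
  ContMDiff I (I.prod 𝓘(ℝ, E →L[ℝ] ℝ)) ∞
    (fun x ↦ TotalSpace.mk' (E →L[ℝ] ℝ) (E := fun x : M ↦ (TangentSpace I x →L[ℝ] ℝ)) x (α x))

/-- Smoothness of a field of endomorphisms, as a section of `End TM`. -/
def IsSmoothEndField (A : EndField I M) : Prop :=
  ContMDiff I (I.prod 𝓘(ℝ, E →L[ℝ] E)) ∞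
    (fun x ↦ TotalSpace.mk' (E →L[ℝ] E)
      (E := fun x : M ↦ (TangentSpace I x →L[ℝ] TangentSpace I x)) x (A x))

/-- Smoothness of a field of bilinear forms, as a section of `Hom(TM, Hom(TM, ℝ))`. -/
def IsSmoothBilinField (b : BilinField I M) : Prop :=
  ContMDiff I (I.prod 𝓘(ℝ, E →L[ℝ] E →L[ℝ] ℝ)) ∞
    (fun x ↦ TotalSpace.mk' (E →L[ℝ] E →L[ℝ] ℝ)
      (E := fun x : M ↦ (TangentSpace I x →L[ℝ] TangentSpace I x →L[ℝ] ℝ)) x (b x))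

/-- Smoothness of a differential form: its value on any smooth vector fields is a smooth
function. -/
def IsSmoothForm {k : ℕ} (σ : DiffForm I M k) : Prop :=
  ∀ X : Fin k → VField I M, (∀ i, IsSmoothVField I (X i)) →
    ContMDiff I 𝓘(ℝ, ℝ) ∞ (fun x ↦ σ x (fun i ↦ X i x))

/-- A covector field, as a differential form of degree one. -/
def CovField.toForm (α : CovField I M) : DiffForm I M 1 :=
  fun x ↦ ContinuousAlternatingMap.ofSubsingleton ℝ (TangentSpace I x) ℝ (0 : Fin 1) (α x)

/-- The expression of a differential form in the preferred chart at `x₀`, i.e. its pullback by the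
inverse of the chart. -/
def formInChart {k : ℕ} (σ : DiffForm I M k) (x₀ : M) : E → E [⋀^Fin k]→L[ℝ] ℝ :=
  fun y ↦ (σ ((extChartAt I x₀).symm y)).compContinuousLinearMap
    (mfderivWithin 𝓘(ℝ, E) I (extChartAt I x₀).symm (range I) y)

/-- The exterior derivative `dσ` of a differential form, computed in charts, with the normalization
`dσ(X₀, …, X_k) = (1 / (k + 1)) ∑ᵢ (-1)ⁱ Xᵢ(σ(X₀, …, X̂ᵢ, …, X_k)) + …` usual in contact metric
geometry. In degree one, `dα(X, Y) = (X(α(Y)) - Y(α(X)) - α([X, Y])) / 2`. (Mathlib's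
`extDerivWithin` has no factor `1 / (k + 1)`.) -/
def extDer {k : ℕ} (σ : DiffForm I M k) : DiffForm I M (k + 1) :=
  fun x ↦ ((k : ℝ) + 1)⁻¹ •
    (extDerivWithin (formInChart I σ x) (range I) (extChartAt I x x)).compContinuousLinearMap
      (mfderiv I 𝓘(ℝ, E) (extChartAt I x) x)

/-- A Riemannian metric: a smooth field of symmetric positive definite bilinear forms. -/
structure IsRiemannianMetric (g : BilinField I M) : Prop where
  smooth : IsSmoothBilinField I g
  symm : ∀ x (u v : TangentSpace I x), g x u v = g x v u
  pos : ∀ x (u : TangentSpace I x), u ≠ 0 → 0 < g x u u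

/-- A symplectic form: a smooth, closed and nondegenerate `2`-form. -/
structure IsSymplecticForm (σ : DiffForm I M 2) : Prop where
  smooth : IsSmoothForm I σ
  closed : extDer I σ = 0
  nondegenerate : ∀ x (u : TangentSpace I x), (∀ v, σ x ![u, v] = 0) → u = 0

/-- An almost complex structure: a smooth section `J` of `End TM` with `J² = -1`. -/
structure IsAlmostComplex (J : EndField I M) : Prop where
  smooth : IsSmoothEndField I J
  sq : ∀ x (u : TangentSpace I x), J x (J x u) = -u

/-- `(M, σ, g)` is almost Kähler with almost complex structure `J`: `σ` is symplectic, `g` is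
Riemannian, `J` is almost complex, and `g(u, v) = σ(u, J v)`. As `σ` is nondegenerate, `J` is
determined by `σ` and `g`. -/
structure IsAlmostKahler (σ : DiffForm I M 2) (g : BilinField I M) (J : EndField I M) : Prop where
  symplectic : IsSymplecticForm I σ
  riemannian : IsRiemannianMetric I g
  almostComplex : IsAlmostComplex I J
  compatible : ∀ x (u v : TangentSpace I x), g x u v = σ x ![u, J x v]

/-- `X` is a Killing vector field of `g`, i.e. `𝓛_X g = 0`:
`X(g(Y, Z)) = g([X, Y], Z) + g(Y, [X, Z])` for all smooth vector fields `Y` and `Z`. -/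
def IsKilling (g : BilinField I M) (X : VField I M) : Prop :=
  ∀ Y Z : VField I M, IsSmoothVField I Y → IsSmoothVField I Z → ∀ x : M,
    mvfderiv I (fun y ↦ g y (Y y) (Z y)) x (X x) =
      g x (VectorField.mlieBracket I X Y x) (Z x) + g x (Y x) (VectorField.mlieBracket I X Z x)

variable (M) in
/-- A complex vector field `re + i im`, i.e. a section of `TM ⊗ ℂ`. -/
structure ComplexVField where
  re : VField I M
  im : VField I M

/-- Smoothness of a complex vector field. -/
def ComplexVField.IsSmooth (Z : ComplexVField I M) : Prop :=
  IsSmoothVField I Z.re ∧ IsSmoothVField I Z.im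

/-- The complex bilinear extension of the Lie bracket to complex vector fields. -/
def ComplexVField.bracket (Z W : ComplexVField I M) : ComplexVField I M where
  re := VectorField.mlieBracket I Z.re W.re - VectorField.mlieBracket I Z.im W.im
  im := VectorField.mlieBracket I Z.re W.im + VectorField.mlieBracket I Z.im W.re

/-- The complex linear extension of a section of `End TM` to complex vector fields. -/
def ComplexVField.map (J : EndField I M) (Z : ComplexVField I M) : ComplexVField I M where
  re := fun x ↦ J x (Z.re x)
  im := fun x ↦ J x (Z.im x)

/-- The complex vector field `Z` is pseudo-holomorphic for `J`, i.e. an infinitesimal automorphism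
of `J`: `𝓛_Z J = 0`, that is `[Z, J W] = J [Z, W]` for all smooth complex vector fields `W`. -/
def IsPseudoHolomorphic (J : EndField I M) (Z : ComplexVField I M) : Prop :=
  ∀ W : ComplexVField I M, W.IsSmooth →
    ComplexVField.bracket I Z (W.map I J) = (ComplexVField.bracket I Z W).map I J

/-- A contact form: a smooth `1`-form `η`, nowhere zero, such that `dη` is nondegenerate on the
hyperplanes `ker η` (on a manifold of dimension `2n + 1`, this says `η ∧ (dη)ⁿ ≠ 0` everywhere). -/
structure IsContactForm (η : CovField I M) : Prop where
  smooth : IsSmoothCovField I η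
  ne_zero : ∀ x, η x ≠ 0
  nondegenerate : ∀ x (u : TangentSpace I x), η x u = 0 →
    (∀ v : TangentSpace I x, η x v = 0 → extDer I (CovField.toForm I η) x ![u, v] = 0) → u = 0

variable (M) in
/-- A metric contact structure: a contact form `η` with its Reeb vector field `ξ`, a section `Φ` of
`End TM` and a Riemannian metric `g` with `Φ² = -1 + ξ ⊗ η`,
`g(u, v) = dη(u, Φ v) + η(u) η(v)` and `g(Φ u, Φ v) = g(u, v) - η(u) η(v)`. -/
structure MetricContactStructure where
  η : CovField I M
  ξ : VField I M
  Φ : EndField I M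
  g : BilinField I M
  contact : IsContactForm I η
  smooth_ξ : IsSmoothVField I ξ
  smooth_Φ : IsSmoothEndField I Φ
  riemannian : IsRiemannianMetric I g
  η_ξ : ∀ x, η x (ξ x) = 1
  dη_ξ : ∀ x (v : TangentSpace I x), extDer I (CovField.toForm I η) x ![ξ x, v] = 0
  Φ_sq : ∀ x (u : TangentSpace I x), Φ x (Φ x u) = -u + η x u • ξ x
  g_eq : ∀ x (u v : TangentSpace I x),
    g x u v = extDer I (CovField.toForm I η) x ![u, Φ x v] + η x u * η x v
  g_Φ : ∀ x (u v : TangentSpace I x), g x (Φ x u) (Φ x v) = g x u v - η x u * η x v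

/-- A metric contact structure is K-contact if its Reeb vector field is a Killing vector field of
its metric. -/
def MetricContactStructure.IsKContact (S : MetricContactStructure I M) : Prop :=
  IsKilling I S.g S.ξ

end Tensors

/-! ### The cone `C(M) = M × ℝ⁺` -/

/-- The open half-line `ℝ⁺` of positive real numbers. -/
def posReals : TopologicalSpace.Opens ℝ := ⟨Ioi 0, isOpen_Ioi⟩

section Cone

variable {E : Type*} [NormedAddCommGroup E] [NormedSpace ℝ E]
  {H : Type*} [TopologicalSpace H] (I : ModelWithCorners ℝ E H)
  (M : Type*) [TopologicalSpace M] [ChartedSpace H M]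

/-- The underlying manifold `M × ℝ⁺` of the cone on `M`. -/
abbrev Cone : Type _ := M × posReals

/-- The model with corners of the cone. -/
abbrev coneModel : ModelWithCorners ℝ (E × ℝ) (ModelProd H ℝ) := I.prod 𝓘(ℝ, ℝ)

variable {M}

/-- The coordinate `r : C(M) → ℝ`. -/
def radius (p : Cone M) : ℝ := (p.2 : ℝ)

/-- The differential of the projection `C(M) → M`: the first projection of
`T_(x,r) C(M) = T_x M × ℝ`. -/
def dproj (p : Cone M) : TangentSpace (coneModel I) p →L[ℝ] TangentSpace I p.1 :=
  ContinuousLinearMap.fst ℝ E ℝ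

/-- The `1`-form `dr` on `C(M)`: the second projection of `T_(x,r) C(M) = T_x M × ℝ`. -/
def dr (p : Cone M) : TangentSpace (coneModel I) p →L[ℝ] ℝ :=
  ContinuousLinearMap.snd ℝ E ℝ

/-- The lift to `T_(x,r) C(M)` of a vector tangent to `M` at `x`, i.e. the vector tangent to
`M × {r}` that projects to it. -/
def lift (p : Cone M) : TangentSpace I p.1 →L[ℝ] TangentSpace (coneModel I) p :=
  ContinuousLinearMap.inl ℝ E ℝ

/-- The Euler vector field `Ψ = r ∂/∂r` on the cone. -/
def euler : VField (coneModel I) (Cone M) := fun p ↦ ((0, radius p) : E × ℝ)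

variable [IsManifold I ∞ M]

/-- The Reeb vector field of `M`, as a vector field on the cone. -/
def coneReeb (S : MetricContactStructure I M) : VField (coneModel I) (Cone M) :=
  fun p ↦ lift I p (S.ξ p.1)

/-- The `1`-form `r² η` on the cone. -/
def coneOneForm (S : MetricContactStructure I M) : CovField (coneModel I) (Cone M) :=
  fun p ↦ radius p ^ 2 • (S.η p.1).comp (dproj I p)

/-- The `2`-form `d(r² η)` on the cone. -/
def coneForm (S : MetricContactStructure I M) : DiffForm (coneModel I) (Cone M) 2 :=
  extDer (coneModel I) (CovField.toForm (coneModel I) (coneOneForm I S))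

/-- The cone metric `dr² + r² g`. -/
def coneMetric (S : MetricContactStructure I M) : BilinField (coneModel I) (Cone M) :=
  fun p ↦ (dr I p).smulRight (dr I p) +
    radius p ^ 2 • (ContinuousLinearMap.precomp ℝ (dproj I p)).comp ((S.g p.1).comp (dproj I p))

/-- The section `J` of `End TC(M)` with `J = Φ` on `ker η ⊆ TM`, `J ξ = -Ψ` and `J Ψ = ξ`. Here `u`
is the sum of the lift of `dproj u` and of `(dr u / r) Ψ`, and `Φ ξ = 0`. -/
def coneJ (S : MetricContactStructure I M) : EndField (coneModel I) (Cone M) :=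
  fun p ↦ ((lift I p).comp (S.Φ p.1)).comp (dproj I p)
    - ((S.η p.1).comp (dproj I p)).smulRight (euler I p)
    + ((radius p)⁻¹ • dr I p).smulRight (coneReeb I S p)

/-- The complex vector field `Ψ - i ξ` on the cone. -/
def eulerSubIReeb (S : MetricContactStructure I M) : ComplexVField (coneModel I) (Cone M) where
  re := euler I
  im := -coneReeb I S

end Cone

end

end AlmostKahlerCone

open VectorField

namespace AlmostKahlerCone

noncomputable section

section Derivations

theorem _root_.ContinuousLinearMap.IsInvertible.apply_inverse_apply {V W : Type*}
    [AddCommGroup V] [Module ℝ V] [TopologicalSpace V] [AddCommGroup W] [Module ℝ W]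
    [TopologicalSpace W] {A : V →L[ℝ] W} (hA : A.IsInvertible) (w : W) : A (A.inverse w) = w := by
  obtain ⟨e, rfl⟩ := hA
  simp

variable {E : Type*} [NormedAddCommGroup E] [NormedSpace ℝ E]
  {H : Type*} [TopologicalSpace H] {I : ModelWithCorners ℝ E H}
  {M : Type*} [TopologicalSpace M] [ChartedSpace H M]
  {F : Type*} [NormedAddCommGroup F] [NormedSpace ℝ F]

variable (I) in
/-- The derivative of the preferred chart at `x₀`, at the point `x`. -/
def chartDeriv (x₀ x : M) : TangentSpace I x →L[ℝ] E :=
  mfderiv I 𝓘(ℝ, E) (extChartAt I x₀) x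

variable (I) in
/-- The derivative of the inverse of the preferred chart at `x₀`, at the point `y`. -/
def chartSymmDeriv (x₀ : M) (y : E) : E →L[ℝ] TangentSpace I ((extChartAt I x₀).symm y) :=
  mfderivWithin 𝓘(ℝ, E) I (extChartAt I x₀).symm (range I) y

/-- The expression of a vector field in the preferred chart at `x₀`. -/
def chartField (X : VField I M) (x₀ : M) : E → E :=
  fun y ↦ mpullbackWithin 𝓘(ℝ, E) I (extChartAt I x₀).symm X (range I) y

theorem formInChart_apply {k : ℕ} (σ : DiffForm I M k) (x₀ : M) (y : E) (v : Fin k → E) :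
    formInChart I σ x₀ y v =
      σ ((extChartAt I x₀).symm y) (fun i ↦ chartSymmDeriv I x₀ y (v i)) :=
  rfl

variable [IsManifold I ∞ M]

omit [IsManifold I ∞ M] in
theorem extDer_apply {k : ℕ} (σ : DiffForm I M k) (x : M) (v : Fin (k + 1) → TangentSpace I x) :
    extDer I σ x v = ((k : ℝ) + 1)⁻¹ *
      extDerivWithin (formInChart I σ x) (range I) (extChartAt I x x)
        (fun i ↦ chartDeriv I x x (v i)) :=
  rfl

theorem chartSymmDeriv_chartField {x₀ : M} {y : E} (hy : y ∈ (extChartAt I x₀).target)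
    (X : VField I M) :
    chartSymmDeriv I x₀ y (chartField X x₀ y) = X ((extChartAt I x₀).symm y) :=
  (isInvertible_mfderivWithin_extChartAt_symm hy).apply_inverse_apply _

theorem isInvertible_chartDeriv {x₀ x : M} (hx : x ∈ (extChartAt I x₀).source) :
    (chartDeriv I x₀ x).IsInvertible :=
  isInvertible_mfderiv_extChartAt hx

theorem chartDeriv_chartSymmDeriv {x₀ : M} {y : E} (hy : y ∈ (extChartAt I x₀).target) (v : E) :
    chartDeriv I x₀ ((extChartAt I x₀).symm y) (chartSymmDeriv I x₀ y v) = v :=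
  congrArg (fun L : E →L[ℝ] E ↦ L v) (mfderiv_extChartAt_comp_mfderivWithin_extChartAt_symm hy)

theorem chartField_apply {x₀ : M} {y : E} (hy : y ∈ (extChartAt I x₀).target) (X : VField I M) :
    chartField X x₀ y =
      chartDeriv I x₀ ((extChartAt I x₀).symm y) (X ((extChartAt I x₀).symm y)) := by
  rw [← chartSymmDeriv_chartField hy X, chartDeriv_chartSymmDeriv hy]

theorem chartField_extChartAt {x₀ x : M} (hx : x ∈ (extChartAt I x₀).source) (X : VField I M) :
    chartField X x₀ (extChartAt I x₀ x) = chartDeriv I x₀ x (X x) := by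
  rw [chartField_apply ((extChartAt I x₀).map_source hx), (extChartAt I x₀).left_inv hx]

theorem fderivWithin_comp_extChartAt_symm {x₀ : M} {y : E} (hy : y ∈ (extChartAt I x₀).target)
    {f : M → F} (hf : MDifferentiableAt I 𝓘(ℝ, F) f ((extChartAt I x₀).symm y)) (v : E) :
    fderivWithin ℝ (f ∘ (extChartAt I x₀).symm) (range I) y v =
      mvfderiv I f ((extChartAt I x₀).symm y) (chartSymmDeriv I x₀ y v) := by
  have h := mfderiv_comp_mfderivWithin (I := 𝓘(ℝ, E)) (I' := I) (I'' := 𝓘(ℝ, F)) y hf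
    (mdifferentiableWithinAt_extChartAt_symm hy)
    ((I.uniqueDiffOn y (extChartAt_target_subset_range x₀ hy)).uniqueMDiffWithinAt)
  rw [mfderivWithin_eq_fderivWithin] at h
  exact congrArg (fun L : E →L[ℝ] F ↦ L v) h

theorem fderivWithin_chartField {x₀ : M} {y : E} (hy : y ∈ (extChartAt I x₀).target)
    {f : M → F} (hf : MDifferentiableAt I 𝓘(ℝ, F) f ((extChartAt I x₀).symm y)) (X : VField I M) :
    fderivWithin ℝ (f ∘ (extChartAt I x₀).symm) (range I) y (chartField X x₀ y) =
      mvfderiv I f ((extChartAt I x₀).symm y) (X ((extChartAt I x₀).symm y)) := by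
  rw [fderivWithin_comp_extChartAt_symm hy hf, chartSymmDeriv_chartField hy]

theorem fderivWithin_chartField_self {x : M}
    {f : M → F} (hf : MDifferentiableAt I 𝓘(ℝ, F) f x) (X : VField I M) :
    fderivWithin ℝ (f ∘ (extChartAt I x).symm) (range I) (extChartAt I x x)
      (chartField X x (extChartAt I x x)) = mvfderiv I f x (X x) := by
  have h := fderivWithin_chartField (mem_extChartAt_target x) (f := f)
    (by rwa [extChartAt_to_inv]) X
  rw [h, extChartAt_to_inv]

theorem chartDeriv_mlieBracket (X Y : VField I M) (x : M) :
    chartDeriv I x x (mlieBracket I X Y x) =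
      lieBracketWithin ℝ (chartField X x) (chartField Y x) (range I) (extChartAt I x x) := by
  have h := mlieBracketWithin_apply (I := I) (V := X) (W := Y) (s := univ) (x₀ := x)
  rw [preimage_univ, univ_inter, mlieBracketWithin_univ] at h
  rw [h]
  exact (isInvertible_chartDeriv (mem_extChartAt_source x)).apply_inverse_apply _

theorem fderivWithin_chartDeriv {x : M}
    {f : M → F} (hf : MDifferentiableAt I 𝓘(ℝ, F) f x) (v : TangentSpace I x) :
    fderivWithin ℝ (f ∘ (extChartAt I x).symm) (range I) (extChartAt I x x)
      (chartDeriv I x x v) = mvfderiv I f x v := by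
  have h := fderivWithin_chartField_self hf (FiberBundle.extend E v)
  rwa [chartField_extChartAt (mem_extChartAt_source x), FiberBundle.extend_apply_self] at h

theorem differentiableWithinAt_chartField [CompleteSpace E] {X : VField I M} {x : M}
    (hX : MDifferentiableAt I I.tangent (fun x ↦ (X x : TangentBundle I M)) x) :
    DifferentiableWithinAt ℝ (chartField X x) (range I) (extChartAt I x x) := by
  have : IsManifold I 2 M := .of_le (n := ∞) (by decide)
  have := (hX.mdifferentiableWithinAt (s := univ)).differentiableWithinAt_mpullbackWithin_vectorField
  rwa [preimage_univ, univ_inter] at this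

omit [IsManifold I ∞ M] in
theorem eventually_mem_extChartAt_target {p : M → Prop} {x : M} (hp : ∀ᶠ z in 𝓝 x, p z) :
    ∀ᶠ y in 𝓝[range I] (extChartAt I x x),
      y ∈ (extChartAt I x).target ∧ p ((extChartAt I x).symm y) := by
  rw [← map_extChartAt_nhds, Filter.eventually_map]
  filter_upwards [extChartAt_source_mem_nhds (I := I) x, hp] with z hz hpz
  exact ⟨(extChartAt I x).map_source hz, by rwa [(extChartAt I x).left_inv hz]⟩

/-- The derivation along a Lie bracket is the commutator of the derivations. -/
theorem mvfderiv_mlieBracket [CompleteSpace E] {f : M → F} {X Y : VField I M} {x : M}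
    (hf : ContMDiffAt I 𝓘(ℝ, F) ∞ f x)
    (hX : MDifferentiableAt I I.tangent (fun x ↦ (X x : TangentBundle I M)) x)
    (hY : MDifferentiableAt I I.tangent (fun x ↦ (Y x : TangentBundle I M)) x)
    (hfX : MDifferentiableAt I 𝓘(ℝ, F) (fun y ↦ mvfderiv I f y (X y)) x)
    (hfY : MDifferentiableAt I 𝓘(ℝ, F) (fun y ↦ mvfderiv I f y (Y y)) x) :
    mvfderiv I f x (mlieBracket I X Y x) =
      mvfderiv I (fun y ↦ mvfderiv I f y (Y y)) x (X x) -
        mvfderiv I (fun y ↦ mvfderiv I f y (X y)) x (Y x) := by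
  have hf1 : ∀ᶠ z in 𝓝 x, MDifferentiableAt I 𝓘(ℝ, F) f z := by
    have h := (contMDiffAt_iff_contMDiffAt_nhds (n := 1) (by simp)).1
      (hf.of_le (m := 1) (by decide))
    exact h.mono fun z hz ↦ hz.mdifferentiableAt one_ne_zero
  have key (Z : VField I M) : (fun y ↦ fderivWithin ℝ (f ∘ (extChartAt I x).symm) (range I) y
      (chartField Z x y)) =ᶠ[𝓝[range I] (extChartAt I x x)]
      (fun y ↦ mvfderiv I f y (Z y)) ∘ (extChartAt I x).symm := by
    filter_upwards [eventually_mem_extChartAt_target hf1] with y hy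
      using fderivWithin_chartField hy.1 hy.2 Z
  have hmem : extChartAt I x x ∈ range I := by
    rw [extChartAt_coe]; exact mem_range_self _
  rw [← fderivWithin_chartDeriv (hf.mdifferentiableAt (by simp)),
    chartDeriv_mlieBracket, fderivWithin_apply_lieBracket (n := ∞),
    (key Y).fderivWithin_eq_of_mem hmem, (key X).fderivWithin_eq_of_mem hmem,
    fderivWithin_chartField_self hfX, fderivWithin_chartField_self hfY]
  · exact (contMDiffAt_iff.1 hf).2
  · rw [minSmoothness_of_isRCLikeNormedField]; decide
  · exact I.uniqueDiffOn
  · exact I.range_subset_closure_interior hmem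
  · exact hmem
  · exact differentiableWithinAt_chartField hY
  · exact differentiableWithinAt_chartField hX

end Derivations

section Bundles

variable {E : Type*} [NormedAddCommGroup E] [NormedSpace ℝ E]
  {H : Type*} [TopologicalSpace H] {I : ModelWithCorners ℝ E H}
  {M : Type*} [TopologicalSpace M] [ChartedSpace H M] {n : ℕ∞ω}

theorem contMDiffWithinAt_clm_of_forall_apply {F₁ F₂ : Type*} [NormedAddCommGroup F₁]
    [NormedSpace ℝ F₁] [FiniteDimensional ℝ F₁] [NormedAddCommGroup F₂] [NormedSpace ℝ F₂]
    {f : M → F₁ →L[ℝ] F₂} {s : Set M} {x : M}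
    (h : ∀ v, ContMDiffWithinAt I 𝓘(ℝ, F₂) n (fun y ↦ f y v) s x) :
    ContMDiffWithinAt I 𝓘(ℝ, F₁ →L[ℝ] F₂) n f s x := by
  let e₁ : F₁ ≃L[ℝ] (Fin (Module.finrank ℝ F₁) → ℝ) :=
    ContinuousLinearEquiv.ofFinrankEq (Module.finrank_fin_fun ℝ).symm
  let e₂ := (e₁.arrowCongr (1 : F₂ ≃L[ℝ] F₂)).trans
    (ContinuousLinearEquiv.piRing (Fin (Module.finrank ℝ F₁)))
  rw [← Function.id_comp f, ← e₂.symm_comp_self]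
  have h2 : ContMDiffWithinAt I 𝓘(ℝ, Fin (Module.finrank ℝ F₁) → F₂) n (e₂ ∘ f) s x :=
    contMDiffWithinAt_pi_space.2 fun i ↦ h _
  exact e₂.symm.contDiff.contMDiff.contMDiffAt.comp_contMDiffWithinAt x h2

variable {F₁ : Type*} [NormedAddCommGroup F₁] [NormedSpace ℝ F₁] [FiniteDimensional ℝ F₁]
  {E₁ : M → Type*} [∀ x, AddCommGroup (E₁ x)] [∀ x, Module ℝ (E₁ x)]
  [∀ x, TopologicalSpace (E₁ x)] [TopologicalSpace (TotalSpace F₁ E₁)] [FiberBundle F₁ E₁]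
  [VectorBundle ℝ F₁ E₁]
  {F₂ : Type*} [NormedAddCommGroup F₂] [NormedSpace ℝ F₂]
  {E₂ : M → Type*} [∀ x, AddCommGroup (E₂ x)] [∀ x, Module ℝ (E₂ x)]
  [∀ x, TopologicalSpace (E₂ x)] [TopologicalSpace (TotalSpace F₂ E₂)] [FiberBundle F₂ E₂]
  [VectorBundle ℝ F₂ E₂] [∀ x, IsTopologicalAddGroup (E₂ x)] [∀ x, ContinuousSMul ℝ (E₂ x)]

/-- A section of a bundle of homomorphisms is smooth if it maps smooth sections to smooth
sections. -/
theorem contMDiffAt_hom_of_forall_section {φ : Π x, E₁ x →L[ℝ] E₂ x} {x₀ : M}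
    (h : ∀ s : Π x, E₁ x, ContMDiffAt I (I.prod 𝓘(ℝ, F₁)) n (fun x ↦ TotalSpace.mk' F₁ x (s x)) x₀ →
      ContMDiffAt I (I.prod 𝓘(ℝ, F₂)) n (fun x ↦ TotalSpace.mk' F₂ x (φ x (s x))) x₀) :
    ContMDiffAt I (I.prod 𝓘(ℝ, F₁ →L[ℝ] F₂)) n
      (fun x ↦ TotalSpace.mk' (F₁ →L[ℝ] F₂) (E := fun x ↦ E₁ x →L[ℝ] E₂ x) x (φ x)) x₀ := by
  rw [contMDiffAt_hom_bundle]
  refine ⟨contMDiffAt_id, contMDiffWithinAt_clm_of_forall_apply fun v ↦ ?_⟩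
  have hx₀ := FiberBundle.mem_baseSet_trivializationAt' (F := F₁) (E := E₁) x₀
  have h1 := h _ (FiberBundle.contMDiffAt_extend I F₁ ((trivializationAt F₁ E₁ x₀).symm x₀ v))
  rw [contMDiffAt_section] at h1
  refine h1.congr_of_eventuallyEq ?_
  filter_upwards [(trivializationAt F₂ E₂ x₀).open_baseSet.mem_nhds
    (FiberBundle.mem_baseSet_trivializationAt' x₀),
    (trivializationAt F₁ E₁ x₀).open_baseSet.mem_nhds hx₀] with x hx hx'
  simp [ContinuousLinearMap.inCoordinates, FiberBundle.extend, hx₀, hx, hx',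
    Bundle.Trivialization.continuousLinearMapAt_apply, Bundle.Trivialization.coe_linearMapAt_of_mem]

end Bundles

section OneForms

variable {E : Type*} [NormedAddCommGroup E] [NormedSpace ℝ E]
  {H : Type*} [TopologicalSpace H] {I : ModelWithCorners ℝ E H}
  {M : Type*} [TopologicalSpace M] [ChartedSpace H M] [IsManifold I ∞ M]

theorem IsSmoothCovField.contMDiffAt_apply {α : CovField I M} (hα : IsSmoothCovField I α)
    {X : VField I M} {x : M} {n : ℕ∞ω} (hn : n ≤ ∞)
    (hX : ContMDiffAt I I.tangent n (fun x ↦ (X x : TangentBundle I M)) x) :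
    ContMDiffAt I 𝓘(ℝ, ℝ) n (fun y ↦ α y (X y)) x := by
  have := ((hα x).of_le hn).clm_bundle_apply (F₁ := E) (E₁ := TangentSpace I) (F₂ := ℝ)
    (E₂ := Bundle.Trivial M ℝ) hX
  simpa [contMDiffAt_section] using this

theorem IsSmoothCovField.mdifferentiableAt_apply {α : CovField I M} (hα : IsSmoothCovField I α)
    {X : VField I M} {x : M}
    (hX : MDifferentiableAt I I.tangent (fun x ↦ (X x : TangentBundle I M)) x) :
    MDifferentiableAt I 𝓘(ℝ, ℝ) (fun y ↦ α y (X y)) x := by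
  have := ((hα x).mdifferentiableAt (by simp)).clm_bundle_apply (F₁ := E)
    (E₁ := TangentSpace I) (F₂ := ℝ) (E₂ := Bundle.Trivial M ℝ) hX
  simpa [mdifferentiableAt_section] using this

theorem isSmoothCovField_of_forall [FiniteDimensional ℝ E] {α : CovField I M}
    (h : ∀ (x : M) (X : VField I M),
      ContMDiffAt I I.tangent ∞ (fun x ↦ (X x : TangentBundle I M)) x →
      ContMDiffAt I 𝓘(ℝ, ℝ) ∞ (fun y ↦ α y (X y)) x) :
    IsSmoothCovField I α := by
  intro x
  apply contMDiffAt_hom_of_forall_section (F₁ := E) (E₁ := TangentSpace I) (F₂ := ℝ)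
    (E₂ := Bundle.Trivial M ℝ)
  intro s hs
  simpa [contMDiffAt_section] using h x s hs

theorem isSmoothEndField_of_forall [FiniteDimensional ℝ E] {A : EndField I M}
    (h : ∀ (x : M) (X : VField I M),
      ContMDiffAt I I.tangent ∞ (fun x ↦ (X x : TangentBundle I M)) x →
      ContMDiffAt I I.tangent ∞ (fun x ↦ (A x (X x) : TangentBundle I M)) x) :
    IsSmoothEndField I A := by
  intro x
  exact contMDiffAt_hom_of_forall_section (F₁ := E) (E₁ := TangentSpace I) (F₂ := E)
    (E₂ := TangentSpace I) (h x)

theorem isSmoothBilinField_of_forall [FiniteDimensional ℝ E] {b : BilinField I M}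
    (h : ∀ (x : M) (X Y : VField I M),
      ContMDiffAt I I.tangent ∞ (fun x ↦ (X x : TangentBundle I M)) x →
      ContMDiffAt I I.tangent ∞ (fun x ↦ (Y x : TangentBundle I M)) x →
      ContMDiffAt I 𝓘(ℝ, ℝ) ∞ (fun y ↦ b y (X y) (Y y)) x) :
    IsSmoothBilinField I b := by
  intro x
  apply contMDiffAt_hom_of_forall_section (F₁ := E) (E₁ := TangentSpace I) (F₂ := E →L[ℝ] ℝ)
    (E₂ := fun x : M ↦ (TangentSpace I x →L[ℝ] ℝ))
  intro X hX
  apply contMDiffAt_hom_of_forall_section (F₁ := E) (E₁ := TangentSpace I) (F₂ := ℝ)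
    (E₂ := Bundle.Trivial M ℝ)
  intro Y hY
  simpa [contMDiffAt_section] using h x X Y hX hY

theorem IsSmoothEndField.contMDiffAt_apply {A : EndField I M} (hA : IsSmoothEndField I A)
    {X : VField I M} {x : M} {n : ℕ∞ω} (hn : n ≤ ∞)
    (hX : ContMDiffAt I I.tangent n (fun x ↦ (X x : TangentBundle I M)) x) :
    ContMDiffAt I I.tangent n (fun y ↦ (A y (X y) : TangentBundle I M)) x :=
  ((hA x).of_le hn).clm_bundle_apply (F₁ := E) (E₁ := TangentSpace I) (F₂ := E)
    (E₂ := TangentSpace I) hX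

theorem IsSmoothEndField.mdifferentiableAt_apply {A : EndField I M} (hA : IsSmoothEndField I A)
    {X : VField I M} {x : M}
    (hX : MDifferentiableAt I I.tangent (fun x ↦ (X x : TangentBundle I M)) x) :
    MDifferentiableAt I I.tangent (fun y ↦ (A y (X y) : TangentBundle I M)) x :=
  ((hA x).mdifferentiableAt (by simp)).clm_bundle_apply (F₁ := E) (E₁ := TangentSpace I) (F₂ := E)
    (E₂ := TangentSpace I) hX

end OneForms

section ExteriorDerivative

theorem extDerivWithin_apply_pair {E : Type*} [NormedAddCommGroup E] [NormedSpace ℝ E]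
    {σ : E → E [⋀^Fin 1]→L[ℝ] ℝ} {V W : E → E} {s : Set E} {x : E}
    (hσ : DifferentiableWithinAt ℝ σ s x) (hV : DifferentiableWithinAt ℝ V s x)
    (hW : DifferentiableWithinAt ℝ W s x) (hs : UniqueDiffWithinAt ℝ s x) :
    extDerivWithin σ s x ![V x, W x] =
      fderivWithin ℝ (fun y ↦ σ y ![W y]) s x (V x) -
        fderivWithin ℝ (fun y ↦ σ y ![V y]) s x (W x) - σ x ![lieBracketWithin ℝ V W s x] := by
  have h := extDerivWithin_apply_vectorField (V := ![V, W]) hσ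
    (by intro i; fin_cases i <;> assumption) hs
  have h0 : (fun i ↦ (![V, W] : Fin 2 → E → E) i x) = ![V x, W x] := by
    ext i; fin_cases i <;> rfl
  have h1 (y : E) : (0 : Fin 2).removeNth (fun i ↦ (![V, W] : Fin 2 → E → E) i y) = ![W y] := by
    ext i; fin_cases i; rfl
  have h2 (y : E) : (1 : Fin 2).removeNth (fun i ↦ (![V, W] : Fin 2 → E → E) i y) = ![V y] := by
    ext i; fin_cases i; rfl
  have h3 : (Finset.Ici (0 : Fin 1)) = {0} := rfl
  have h4 (w : E) (u : Fin 0 → E) : (Matrix.vecCons w u : Fin 1 → E) = ![w] := by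
    ext i; fin_cases i; rfl
  simp only [Nat.reduceAdd, Fin.sum_univ_two, h1, h2, h0] at h
  simp only [Finset.univ_unique, Finset.sum_singleton, Fin.default_eq_zero,
    h3, h4] at h
  rw [h]
  simp
  rfl

variable {E : Type*} [NormedAddCommGroup E] [NormedSpace ℝ E]
  {H : Type*} [TopologicalSpace H] {I : ModelWithCorners ℝ E H}
  {M : Type*} [TopologicalSpace M] [ChartedSpace H M]

theorem formInChart_toForm_apply (α : CovField I M) (x₀ : M) (y : E) (v : Fin 1 → E) :
    formInChart I (CovField.toForm I α) x₀ y v =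
      α ((extChartAt I x₀).symm y) (chartSymmDeriv I x₀ y (v 0)) :=
  rfl

variable [IsManifold I ∞ M]

theorem symm_trivializationAt_extChartAt_symm {x₀ : M} {y : E} (hy : y ∈ (extChartAt I x₀).target)
    (v : E) :
    (trivializationAt E (TangentSpace I) x₀).symm ((extChartAt I x₀).symm y) v =
      chartSymmDeriv I x₀ y v := by
  have hs : (extChartAt I x₀).symm y ∈ (chartAt H x₀).source := by
    rw [← extChartAt_source I]; exact (extChartAt I x₀).map_target hy
  have h := TangentBundle.symmL_trivializationAt (I := I) hs
  rw [(extChartAt I x₀).right_inv hy] at h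
  rw [← Bundle.Trivialization.symmL_apply (R := ℝ) _ (by simpa using hs)]
  exact congrArg (fun L : E →L[ℝ] TangentSpace I ((extChartAt I x₀).symm y) ↦ L v) h

theorem contDiffWithinAt_formInChart [FiniteDimensional ℝ E] {α : CovField I M}
    (hα : IsSmoothCovField I α) (x : M) :
    ContDiffWithinAt ℝ ∞ (formInChart I (CovField.toForm I α) x) (range I) (extChartAt I x x) := by
  have hx := FiberBundle.mem_baseSet_trivializationAt' (F := E) (E := TangentSpace I) x
  have hmem : extChartAt I x x ∈ range I := by
    rw [extChartAt_coe]; exact mem_range_self _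
  have h (v : E) : ContMDiffWithinAt 𝓘(ℝ, E) 𝓘(ℝ, ℝ) ∞ (fun y ↦
      (α ((extChartAt I x).symm y)).comp (chartSymmDeriv I x y) v) (range I) (extChartAt I x x) := by
    have hf := hα.contMDiffAt_apply le_rfl (FiberBundle.contMDiffAt_extend I E
      ((trivializationAt E (TangentSpace I) x).symm x v))
    have h2 := ((contMDiffAt_iff.1 hf).2).contMDiffWithinAt
    refine h2.congr_of_eventuallyEq_of_mem ?_ hmem
    filter_upwards [extChartAt_target_mem_nhdsWithin (I := I) x] with y hy
    rw [ContinuousLinearMap.comp_apply, ← symm_trivializationAt_extChartAt_symm hy]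
    rw [extChartAt_model_space_eq_id]
    simp only [PartialEquiv.refl_coe, Function.comp_apply, id_eq, FiberBundle.extend]
    rw [Bundle.Trivialization.apply_mk_symm _ hx]
  have h' := (contMDiffWithinAt_clm_of_forall_apply h).contDiffWithinAt
  exact (ContinuousAlternatingMap.ofSubsingletonLIE (0 : Fin 1)).contDiff.contDiffAt
    |>.comp_contDiffWithinAt _ h'

/-- Cartan's formula for the exterior derivative of a `1`-form. -/
theorem extDer_toForm_apply [FiniteDimensional ℝ E] {α : CovField I M} (hα : IsSmoothCovField I α)
    {X Y : VField I M} {x : M}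
    (hX : MDifferentiableAt I I.tangent (fun x ↦ (X x : TangentBundle I M)) x)
    (hY : MDifferentiableAt I I.tangent (fun x ↦ (Y x : TangentBundle I M)) x) :
    extDer I (CovField.toForm I α) x ![X x, Y x] =
      2⁻¹ * (mvfderiv I (fun y ↦ α y (Y y)) x (X x) - mvfderiv I (fun y ↦ α y (X y)) x (Y x) -
        α x (mlieBracket I X Y x)) := by
  have : CompleteSpace E := FiniteDimensional.complete ℝ E
  have hmem : extChartAt I x x ∈ range I := by
    rw [extChartAt_coe]; exact mem_range_self _
  have key (Z : VField I M) : (fun y ↦ α ((extChartAt I x).symm y)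
      (chartSymmDeriv I x y (chartField Z x y))) =ᶠ[𝓝[range I] (extChartAt I x x)]
      (fun y ↦ α y (Z y)) ∘ (extChartAt I x).symm := by
    filter_upwards [extChartAt_target_mem_nhdsWithin (I := I) x] with y hy
    rw [chartSymmDeriv_chartField hy]; rfl
  have hV : (fun i ↦ chartDeriv I x x ((![X x, Y x] : Fin 2 → TangentSpace I x) i)) =
      ![chartField X x (extChartAt I x x), chartField Y x (extChartAt I x x)] := by
    rw [chartField_extChartAt (mem_extChartAt_source x),
      chartField_extChartAt (mem_extChartAt_source x)]
    ext i
    fin_cases i <;> rfl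
  have hbr : α ((extChartAt I x).symm (extChartAt I x x)) (chartSymmDeriv I x (extChartAt I x x)
      (lieBracketWithin ℝ (chartField X x) (chartField Y x) (range I) (extChartAt I x x))) =
      α x (mlieBracket I X Y x) := by
    rw [← chartDeriv_mlieBracket, ← chartField_extChartAt (mem_extChartAt_source x)
      (mlieBracket I X Y), chartSymmDeriv_chartField (mem_extChartAt_target x), extChartAt_to_inv]
  rw [extDer_apply, hV, extDerivWithin_apply_pair
    ((contDiffWithinAt_formInChart hα x).differentiableWithinAt (by simp))
    (differentiableWithinAt_chartField hX) (differentiableWithinAt_chartField hY)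
    (I.uniqueDiffOn _ hmem)]
  simp only [formInChart_toForm_apply, Matrix.cons_val_zero]
  rw [hbr, (key X).fderivWithin_eq_of_mem hmem, (key Y).fderivWithin_eq_of_mem hmem,
    fderivWithin_chartField_self (hα.mdifferentiableAt_apply hX),
    fderivWithin_chartField_self (hα.mdifferentiableAt_apply hY)]
  norm_num

theorem formInChart_extChartAt {k : ℕ} (σ : DiffForm I M k) {x₀ x : M}
    (hx : x ∈ (extChartAt I x₀).source) (u : Fin k → TangentSpace I x) :
    formInChart I σ x₀ (extChartAt I x₀ x) (fun i ↦ chartDeriv I x₀ x (u i)) = σ x u := by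
  have h (i : Fin k) : chartDeriv I x₀ x (u i) =
      chartField (FiberBundle.extend E (u i)) x₀ (extChartAt I x₀ x) := by
    rw [chartField_extChartAt hx, FiberBundle.extend_apply_self]
  have h' (x' : M) (hx' : x' = x) : σ x' (fun i ↦ FiberBundle.extend E (u i) x') = σ x u := by
    subst hx'
    simp only [FiberBundle.extend_apply_self]
  simp only [h, formInChart_apply, chartSymmDeriv_chartField ((extChartAt I x₀).map_source hx)]
  exact h' _ ((extChartAt I x₀).left_inv hx)

theorem fderiv_extChartAt_comp_symm [I.Boundaryless] {x₀ x : M} {y : E}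
    (hy : y ∈ (extChartAt I x₀).target) (hx : (extChartAt I x₀).symm y ∈ (extChartAt I x).source)
    (v : E) :
    fderiv ℝ (extChartAt I x ∘ (extChartAt I x₀).symm) y v =
      chartDeriv I x ((extChartAt I x₀).symm y) (chartSymmDeriv I x₀ y v) := by
  rw [extChartAt_source] at hx
  rw [← fderivWithin_univ, ← I.range_eq_univ,
    fderivWithin_comp_extChartAt_symm hy (mdifferentiableAt_extChartAt hx)]
  rfl

/-- The exterior derivative can be computed in any chart. -/
theorem formInChart_extDer {k : ℕ} {σ : DiffForm I M k} [I.Boundaryless] {x₀ : M} {y : E}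
    (hy : y ∈ (extChartAt I x₀).target)
    (hσ : ∀ x, DifferentiableAt ℝ (formInChart I σ x) (extChartAt I x x)) :
    formInChart I (extDer I σ) x₀ y = ((k : ℝ) + 1)⁻¹ • extDeriv (formInChart I σ x₀) y := by
  set x := (extChartAt I x₀).symm y with hx
  have hxs := mem_extChartAt_source (I := I) x
  have hmem : y ∈ ((extChartAt I x₀).symm ≫ extChartAt I x).source := by
    rw [PartialEquiv.trans_source]
    exact ⟨hy, hxs⟩
  have hψ : ContDiffAt ℝ ∞ (extChartAt I x ∘ (extChartAt I x₀).symm) y := by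
    have := contDiffWithinAt_ext_coord_change (I := I) (n := ∞) x x₀ hmem
    rwa [I.range_eq_univ] at this
  have hpull := extDeriv_pullback (f := extChartAt I x ∘ (extChartAt I x₀).symm)
    (x := y) (r := ∞) (show DifferentiableAt ℝ (formInChart I σ x) _ from hσ x) hψ
    (by rw [minSmoothness_of_isRCLikeNormedField]; decide)
  have hev : (fun z ↦ (formInChart I σ x ((extChartAt I x ∘ (extChartAt I x₀).symm) z))
      |>.compContinuousLinearMap (fderiv ℝ (extChartAt I x ∘ (extChartAt I x₀).symm) z)) =ᶠ[𝓝 y]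
      formInChart I σ x₀ := by
    have h1 : ∀ᶠ z in 𝓝 y, z ∈ (extChartAt I x₀).target :=
      (isOpen_extChartAt_target x₀).mem_nhds hy
    have h2 : ∀ᶠ z in 𝓝 y, (extChartAt I x₀).symm z ∈ (extChartAt I x).source :=
      (continuousAt_extChartAt_symm'' hy).preimage_mem_nhds
        ((isOpen_extChartAt_source x).mem_nhds hxs)
    filter_upwards [h1, h2] with z hz hz'
    ext v
    rw [ContinuousAlternatingMap.compContinuousLinearMap_apply]
    have h3 : (⇑(fderiv ℝ (extChartAt I x ∘ (extChartAt I x₀).symm) z) ∘ v) =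
        fun i ↦ chartDeriv I x ((extChartAt I x₀).symm z) (chartSymmDeriv I x₀ z (v i)) :=
      funext fun i ↦ fderiv_extChartAt_comp_symm hz hz' (v i)
    rw [h3]
    exact formInChart_extChartAt σ hz' _
  rw [hev.extDeriv_eq] at hpull
  ext v
  rw [formInChart_apply, extDer_apply, hpull, I.range_eq_univ, extDerivWithin_univ]
  rw [ContinuousAlternatingMap.smul_apply, ContinuousAlternatingMap.compContinuousLinearMap_apply]
  have h3 : (⇑(fderiv ℝ (extChartAt I x ∘ (extChartAt I x₀).symm) y) ∘ v) =
        fun i ↦ chartDeriv I x ((extChartAt I x₀).symm y) (chartSymmDeriv I x₀ y (v i)) :=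
      funext fun i ↦ fderiv_extChartAt_comp_symm hy hxs (v i)
  rw [h3]
  rfl

theorem extDer_extDer_toForm [FiniteDimensional ℝ E] [I.Boundaryless] {α : CovField I M}
    (hα : IsSmoothCovField I α) : extDer I (extDer I (CovField.toForm I α)) = 0 := by
  have hc (x : M) : ContDiffAt ℝ ∞ (formInChart I (CovField.toForm I α) x) (extChartAt I x x) := by
    have := contDiffWithinAt_formInChart hα x
    rwa [I.range_eq_univ] at this
  ext x v
  rw [extDer_apply, I.range_eq_univ, extDerivWithin_univ]
  have hev : formInChart I (extDer I (CovField.toForm I α)) x =ᶠ[𝓝 (extChartAt I x x)]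
      (((1 : ℕ) : ℝ) + 1)⁻¹ • extDeriv (formInChart I (CovField.toForm I α) x) := by
    filter_upwards [extChartAt_target_mem_nhds (I := I) x] with y hy
    exact formInChart_extDer hy fun x ↦ (hc x).differentiableAt (by simp)
  rw [hev.extDeriv_eq, extDeriv_smul,
    extDeriv_extDeriv_apply (hc x) (by rw [minSmoothness_of_isRCLikeNormedField]; decide)]
  simp

end ExteriorDerivative

section AlternatingPairs

variable {V : Type*} [AddCommGroup V] [Module ℝ V] [TopologicalSpace V] (σ : V [⋀^Fin 2]→L[ℝ] ℝ)

theorem pair_add_right (u v w : V) : σ ![u, v + w] = σ ![u, v] + σ ![u, w] := by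
  have h (v : V) : ![u, v] = Function.update ![u, 0] (1 : Fin 2) v := by
    ext i; fin_cases i <;> rfl
  rw [h (v + w), σ.map_update_add, ← h, ← h]

theorem pair_smul_right (c : ℝ) (u v : V) : σ ![u, c • v] = c * σ ![u, v] := by
  have h (v : V) : ![u, v] = Function.update ![u, 0] (1 : Fin 2) v := by
    ext i; fin_cases i <;> rfl
  rw [h (c • v), σ.map_update_smul, ← h, smul_eq_mul]

theorem pair_swap (u v : V) : σ ![u, v] = -σ ![v, u] := by
  have h : σ (![v, u] ∘ Equiv.swap (0 : Fin 2) 1) = -σ ![v, u] :=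
    σ.toAlternatingMap.map_swap _ (by decide)
  rw [← h]
  congr 1
  ext i; fin_cases i <;> rfl

theorem pair_neg_right (u v : V) : σ ![u, -v] = -σ ![u, v] := by
  rw [← neg_one_smul ℝ, pair_smul_right]; ring

theorem pair_sub_right (u v w : V) : σ ![u, v - w] = σ ![u, v] - σ ![u, w] := by
  rw [sub_eq_add_neg, pair_add_right, pair_neg_right]; ring

end AlternatingPairs

section SmoothFields

variable {E : Type*} [NormedAddCommGroup E] [NormedSpace ℝ E]
  {H : Type*} [TopologicalSpace H] {I : ModelWithCorners ℝ E H}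
  {M : Type*} [TopologicalSpace M] [ChartedSpace H M] [IsManifold I ∞ M]
  {F : Type*} [NormedAddCommGroup F] [NormedSpace ℝ F]

theorem IsSmoothVField.mdifferentiableAt {X : VField I M} (hX : IsSmoothVField I X) (x : M) :
    MDifferentiableAt I I.tangent (fun x ↦ (X x : TangentBundle I M)) x :=
  (hX x).mdifferentiableAt (by simp)

theorem IsSmoothVField.contMDiff_mvfderiv {X : VField I M} (hX : IsSmoothVField I X) {f : M → F}
    (hf : ContMDiff I 𝓘(ℝ, F) ∞ f) : ContMDiff I 𝓘(ℝ, F) ∞ (fun x ↦ mvfderiv I f x (X x)) :=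
  (contMDiff_snd_tangentBundle_modelSpace F 𝓘(ℝ, F)).comp
    ((hf.contMDiff_tangentMap (m := ∞) (by decide)).comp hX)

theorem IsSmoothVField.mlieBracket [CompleteSpace E] {X Y : VField I M} (hX : IsSmoothVField I X)
    (hY : IsSmoothVField I Y) : IsSmoothVField I (mlieBracket I X Y) := by
  have : IsManifold I (minSmoothness ℝ 2) M := by
    rw [minSmoothness_of_isRCLikeNormedField]; exact .of_le (n := ∞) (by decide)
  have : IsManifold I (((⊤ : ℕ∞) : ℕ∞ω) + 1) M := ‹IsManifold I ∞ M›
  exact ContDiff.mlieBracket_vectorField (n := ⊤) (m := ⊤) hX hY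
    (by rw [minSmoothness_of_isRCLikeNormedField]; decide)

theorem IsSmoothEndField.apply {A : EndField I M} (hA : IsSmoothEndField I A) {X : VField I M}
    (hX : IsSmoothVField I X) : IsSmoothVField I (fun x ↦ A x (X x)) :=
  fun x ↦ hA.contMDiffAt_apply le_rfl (hX x)

theorem IsSmoothCovField.apply {α : CovField I M} (hα : IsSmoothCovField I α) {X : VField I M}
    (hX : IsSmoothVField I X) : ContMDiff I 𝓘(ℝ, ℝ) ∞ (fun x ↦ α x (X x)) :=
  fun x ↦ hα.contMDiffAt_apply le_rfl (hX x)

/-- The derivation along a Lie bracket of smooth vector fields is the commutator of the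
derivations. -/
theorem mvfderiv_mlieBracket_of_smooth [CompleteSpace E] {f : M → F} {X Y : VField I M}
    (hf : ContMDiff I 𝓘(ℝ, F) ∞ f) (hX : IsSmoothVField I X) (hY : IsSmoothVField I Y) (x : M) :
    mvfderiv I f x (mlieBracket I X Y x) =
      mvfderiv I (fun y ↦ mvfderiv I f y (Y y)) x (X x) -
        mvfderiv I (fun y ↦ mvfderiv I f y (X y)) x (Y x) :=
  mvfderiv_mlieBracket (hf x) (hX.mdifferentiableAt x) (hY.mdifferentiableAt x)
    ((hX.contMDiff_mvfderiv hf x).mdifferentiableAt (by simp))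
    ((hY.contMDiff_mvfderiv hf x).mdifferentiableAt (by simp))

theorem jacobi_mlieBracket [CompleteSpace E] {X Y Z : VField I M} (hX : IsSmoothVField I X)
    (hY : IsSmoothVField I Y) (hZ : IsSmoothVField I Z) (x : M) :
    mlieBracket I X (mlieBracket I Y Z) x =
      mlieBracket I (mlieBracket I X Y) Z x + mlieBracket I Y (mlieBracket I X Z) x := by
  have hs : minSmoothness ℝ 2 ≤ ∞ := by
    rw [minSmoothness_of_isRCLikeNormedField]; decide
  have : IsManifold I (minSmoothness ℝ 3) M := by
    rw [minSmoothness_of_isRCLikeNormedField]; exact .of_le (n := ∞) (by decide)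
  exact leibniz_identity_mlieBracket_apply ((hX x).of_le hs) ((hY x).of_le hs) ((hZ x).of_le hs)

theorem contMDiff_extDer_toForm [FiniteDimensional ℝ E] {α : CovField I M}
    (hα : IsSmoothCovField I α) {X Y : VField I M} (hX : IsSmoothVField I X)
    (hY : IsSmoothVField I Y) :
    ContMDiff I 𝓘(ℝ, ℝ) ∞ (fun x ↦ extDer I (CovField.toForm I α) x ![X x, Y x]) := by
  have : CompleteSpace E := FiniteDimensional.complete ℝ E
  simp only [fun x ↦ extDer_toForm_apply hα (hX.mdifferentiableAt x) (hY.mdifferentiableAt x)]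
  exact contMDiff_const.mul (((hX.contMDiff_mvfderiv (hα.apply hY)).sub
    (hY.contMDiff_mvfderiv (hα.apply hX))).sub (hα.apply (hX.mlieBracket hY)))

/-- If `ξ ⌟ dα = 0` and `α(ξ)` is constant then `𝓛_ξ α = 0`. -/
theorem mvfderiv_apply_of_extDer_eq_zero [FiniteDimensional ℝ E] {α : CovField I M}
    (hα : IsSmoothCovField I α) {ξ : VField I M} (hξ : IsSmoothVField I ξ) {c : ℝ}
    (hc : ∀ x, α x (ξ x) = c)
    (h : ∀ x (v : TangentSpace I x), extDer I (CovField.toForm I α) x ![ξ x, v] = 0)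
    {Y : VField I M} {x : M}
    (hY : MDifferentiableAt I I.tangent (fun x ↦ (Y x : TangentBundle I M)) x) :
    mvfderiv I (fun y ↦ α y (Y y)) x (ξ x) = α x (mlieBracket I ξ Y x) := by
  have h1 := extDer_toForm_apply hα (hξ.mdifferentiableAt x) hY
  have h2 : mvfderiv I (fun y ↦ α y (ξ y)) x = 0 := by
    simp only [hc]; exact mvfderiv_const c
  rw [h, h2, zero_apply] at h1
  linarith

/-- If `ξ ⌟ dα = 0` and `α(ξ)` is constant then `𝓛_ξ dα = 0`. -/
theorem mvfderiv_extDer_apply_of_extDer_eq_zero [FiniteDimensional ℝ E] {α : CovField I M}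
    (hα : IsSmoothCovField I α) {ξ : VField I M} (hξ : IsSmoothVField I ξ) {c : ℝ}
    (hc : ∀ x, α x (ξ x) = c)
    (h : ∀ x (v : TangentSpace I x), extDer I (CovField.toForm I α) x ![ξ x, v] = 0)
    {Y Z : VField I M} (hY : IsSmoothVField I Y) (hZ : IsSmoothVField I Z) (x : M) :
    mvfderiv I (fun y ↦ extDer I (CovField.toForm I α) y ![Y y, Z y]) x (ξ x) =
      extDer I (CovField.toForm I α) x ![mlieBracket I ξ Y x, Z x] +
      extDer I (CovField.toForm I α) x ![Y x, mlieBracket I ξ Z x] := by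
  have : CompleteSpace E := FiniteDimensional.complete ℝ E
  have hL {V : VField I M} (hV : IsSmoothVField I V) (x : M) :
      mvfderiv I (fun y ↦ α y (V y)) x (ξ x) = α x (mlieBracket I ξ V x) :=
    mvfderiv_apply_of_extDer_eq_zero hα hξ hc h (hV.mdifferentiableAt x)
  have hd {f : M → ℝ} (hf : ContMDiff I 𝓘(ℝ, ℝ) ∞ f) : MDifferentiableAt I 𝓘(ℝ, ℝ) f x :=
    (hf x).mdifferentiableAt (by simp)
  have hξY := hξ.mlieBracket hY
  have hξZ := hξ.mlieBracket hZ
  have hYZ := hY.mlieBracket hZ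
  have hYη := hY.contMDiff_mvfderiv (hα.apply hZ)
  have hZη := hZ.contMDiff_mvfderiv (hα.apply hY)
  have hdα (y : M) := extDer_toForm_apply hα (hY.mdifferentiableAt y) (hZ.mdifferentiableAt y)
  have e1 := mvfderiv_mlieBracket_of_smooth (hα.apply hZ) hξ hY x
  have e2 := mvfderiv_mlieBracket_of_smooth (hα.apply hY) hξ hZ x
  simp only [hL hY, hL hZ] at e1 e2
  have e3 := congrArg (α x) (jacobi_mlieBracket hξ hY hZ x)
  rw [map_add] at e3
  rw [extDer_toForm_apply hα (hξY.mdifferentiableAt x) (hZ.mdifferentiableAt x),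
    extDer_toForm_apply hα (hY.mdifferentiableAt x) (hξZ.mdifferentiableAt x)]
  simp only [hdα]
  have e4 : mvfderiv I (fun y ↦ 2⁻¹ * (mvfderiv I (fun y ↦ α y (Z y)) y (Y y) -
      mvfderiv I (fun y ↦ α y (Y y)) y (Z y) - α y (mlieBracket I Y Z y))) x (ξ x) =
      2⁻¹ * (mvfderiv I (fun y ↦ mvfderiv I (fun y ↦ α y (Z y)) y (Y y)) x (ξ x) -
        mvfderiv I (fun y ↦ mvfderiv I (fun y ↦ α y (Y y)) y (Z y)) x (ξ x) -
        mvfderiv I (fun y ↦ α y (mlieBracket I Y Z y)) x (ξ x)) := by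
    have hsub := (hd hYη).sub (hd hZη)
    have hsub' := hsub.sub (hd (hα.apply hYZ))
    erw [mvfderiv_fun_mul mdifferentiableAt_const hsub', mvfderiv_const,
      mvfderiv_sub hsub (hd (hα.apply hYZ)), mvfderiv_sub (hd hYη) (hd hZη)]
    simp
  rw [e4, hL hYZ, e3]
  linarith

end SmoothFields

section KContact

variable {E : Type*} [NormedAddCommGroup E] [NormedSpace ℝ E]
  {H : Type*} [TopologicalSpace H] {I : ModelWithCorners ℝ E H}
  {M : Type*} [TopologicalSpace M] [ChartedSpace H M] [IsManifold I ∞ M]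

namespace MetricContactStructure

variable (S : MetricContactStructure I M)

theorem g_ξ_ξ (x : M) : S.g x (S.ξ x) (S.ξ x) = 1 := by
  rw [S.g_eq, S.dη_ξ, S.η_ξ]; norm_num

theorem Φ_ξ (x : M) : S.Φ x (S.ξ x) = 0 := by
  by_contra h
  have := S.riemannian.pos x _ h
  rw [S.g_Φ, S.g_ξ_ξ, S.η_ξ] at this
  norm_num at this

theorem η_Φ (x : M) (u : TangentSpace I x) : S.η x (S.Φ x u) = 0 := by
  have h := congrArg (S.Φ x) (S.Φ_sq x u)
  rw [S.Φ_sq, map_add, map_smul, S.Φ_ξ, map_neg, smul_zero, add_zero, add_eq_left] at h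
  simpa [S.η_ξ] using congrArg (S.η x) h

theorem dη_Φ_self (x : M) (u : TangentSpace I x) (hu : S.η x u = 0)
    (h : extDer I (CovField.toForm I S.η) x ![S.Φ x u, u] = 0) : u = 0 := by
  by_contra h0
  have := S.riemannian.pos x u h0
  have h2 := S.g_eq x (S.Φ x u) (S.Φ x u)
  rw [S.g_Φ, S.Φ_sq, hu, η_Φ, zero_smul, add_zero] at h2
  rw [pair_neg_right, h] at h2
  linarith

variable [FiniteDimensional ℝ E]

theorem mvfderiv_η {Y : VField I M} {x : M}
    (hY : MDifferentiableAt I I.tangent (fun x ↦ (Y x : TangentBundle I M)) x) :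
    mvfderiv I (fun y ↦ S.η y (Y y)) x (S.ξ x) = S.η x (mlieBracket I S.ξ Y x) :=
  mvfderiv_apply_of_extDer_eq_zero S.contact.smooth S.smooth_ξ S.η_ξ S.dη_ξ hY

/-- `(𝓛_ξ g)(Y, Z) = dη(Y, (𝓛_ξ Φ) Z)`. -/
theorem mvfderiv_g {Y Z : VField I M} (hY : IsSmoothVField I Y) (hZ : IsSmoothVField I Z) (x : M) :
    mvfderiv I (fun y ↦ S.g y (Y y) (Z y)) x (S.ξ x) =
      S.g x (mlieBracket I S.ξ Y x) (Z x) + S.g x (Y x) (mlieBracket I S.ξ Z x) +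
      extDer I (CovField.toForm I S.η) x ![Y x, mlieBracket I S.ξ (fun y ↦ S.Φ y (Z y)) x -
        S.Φ x (mlieBracket I S.ξ Z x)] := by
  have hΦZ := S.smooth_Φ.apply hZ
  have hd {f : M → ℝ} (hf : ContMDiff I 𝓘(ℝ, ℝ) ∞ f) : MDifferentiableAt I 𝓘(ℝ, ℝ) f x :=
    (hf x).mdifferentiableAt (by simp)
  have hη {V : VField I M} (hV : IsSmoothVField I V) := hd (S.contact.smooth.apply hV)
  have hdη := hd (contMDiff_extDer_toForm S.contact.smooth hY hΦZ)
  have hmul : MDifferentiableAt I 𝓘(ℝ, ℝ) (fun y ↦ S.η y (Y y) * S.η y (Z y)) x :=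
    (hη hY).mul (hη hZ)
  simp only [S.g_eq]
  rw [mvfderiv_fun_add hdη hmul, mvfderiv_fun_mul (hη hY) (hη hZ), add_apply,
    mvfderiv_extDer_apply_of_extDer_eq_zero S.contact.smooth S.smooth_ξ S.η_ξ S.dη_ξ hY hΦZ,
    add_apply, smul_apply, smul_apply, S.mvfderiv_η (hY.mdifferentiableAt x),
    S.mvfderiv_η (hZ.mdifferentiableAt x), pair_sub_right, smul_eq_mul, smul_eq_mul]
  ring

theorem isKContact_iff : S.IsKContact ↔ ∀ Z : VField I M, IsSmoothVField I Z → ∀ x,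
    mlieBracket I S.ξ (fun y ↦ S.Φ y (Z y)) x = S.Φ x (mlieBracket I S.ξ Z x) := by
  have : CompleteSpace E := FiniteDimensional.complete ℝ E
  refine ⟨fun h Z hZ x ↦ ?_, fun h Y Z hY hZ x ↦ ?_⟩
  · have hΦZ := S.smooth_Φ.apply hZ
    have hT : IsSmoothVField I (fun x ↦ mlieBracket I S.ξ (fun y ↦ S.Φ y (Z y)) x -
        S.Φ x (mlieBracket I S.ξ Z x)) :=
      ContMDiff.sub_section (S.smooth_ξ.mlieBracket hΦZ)
        (S.smooth_Φ.apply (S.smooth_ξ.mlieBracket hZ))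
    have h1 := S.mvfderiv_g (S.smooth_Φ.apply hT) hZ x
    rw [h _ _ (S.smooth_Φ.apply hT) hZ, left_eq_add] at h1
    refine sub_eq_zero.1 (S.dη_Φ_self x _ ?_ h1)
    rw [map_sub, S.η_Φ, sub_zero, ← S.mvfderiv_η (hΦZ.mdifferentiableAt x)]
    simp only [S.η_Φ]
    rw [mvfderiv_const, zero_apply]
  · rw [S.mvfderiv_g hY hZ x, h Z hZ x, sub_self, ← zero_smul ℝ (0 : TangentSpace I x),
      pair_smul_right, zero_mul, add_zero]

end MetricContactStructure

end KContact

section ConeFields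

theorem mfderiv_val_posReals (s : posReals) :
    mfderiv 𝓘(ℝ, ℝ) 𝓘(ℝ, ℝ) (Subtype.val : posReals → ℝ) s = ContinuousLinearMap.id ℝ ℝ := by
  have h : MDifferentiableAt 𝓘(ℝ, ℝ) 𝓘(ℝ, ℝ) (Subtype.val : posReals → ℝ) s :=
    ((contMDiff_subtype_val (I := 𝓘(ℝ, ℝ)) (n := 1)) s).mdifferentiableAt (by simp)
  rw [h.mfderiv]
  have h0 : s ∈ (chartAt ℝ s).source := mem_chart_source ℝ s
  have h2 : writtenInExtChartAt 𝓘(ℝ, ℝ) 𝓘(ℝ, ℝ) s (Subtype.val : posReals → ℝ)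
      =ᶠ[𝓝 (s : ℝ)] id := by
    filter_upwards [(chartAt ℝ s).open_target.mem_nhds ((chartAt ℝ s).map_source h0)] with t ht
    exact (chartAt ℝ s).right_inv ht
  have h3 : extChartAt 𝓘(ℝ, ℝ) s s = (s : ℝ) := rfl
  rw [modelWithCornersSelf_coe, range_id, fderivWithin_univ, h3, h2.fderiv_eq, fderiv_id]

/-- The unit vector field on the half-line. -/
def unitField : VField 𝓘(ℝ, ℝ) posReals := fun _ ↦ (1 : ℝ)

theorem isSmoothVField_unitField : IsSmoothVField 𝓘(ℝ, ℝ) unitField := by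
  have h1 : ContMDiff 𝓘(ℝ, ℝ) 𝓘(ℝ, ℝ).tangent ∞
      (fun s : ℝ ↦ (⟨s, (1 : ℝ)⟩ : TangentBundle 𝓘(ℝ, ℝ) ℝ)) :=
    contMDiff_vectorSpace_iff_contDiff.2 contDiff_const
  have h2 := h1.mpullback_vectorField (I := 𝓘(ℝ, ℝ)) (f := (Subtype.val : posReals → ℝ))
    (n := ∞) (m := ∞) contMDiff_subtype_val
    (fun s ↦ by rw [mfderiv_val_posReals]; exact .of_inverse (g := .id ℝ ℝ) rfl rfl) (by decide)
  refine h2.congr fun s ↦ congrArg _ ?_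
  exact ((congrArg (fun A : ℝ →L[ℝ] ℝ ↦ A.inverse 1) (mfderiv_val_posReals s)).trans
    (congrArg (fun A : ℝ →L[ℝ] ℝ ↦ A 1) ContinuousLinearMap.inverse_id)).symm

variable {E : Type*} [NormedAddCommGroup E] [NormedSpace ℝ E]
  {H : Type*} [TopologicalSpace H] {I : ModelWithCorners ℝ E H}
  {M : Type*} [TopologicalSpace M] [ChartedSpace H M]

omit [TopologicalSpace M] in
theorem radius_pos (p : Cone M) : 0 < radius p := p.2.2

theorem contMDiff_radius : ContMDiff (coneModel I) 𝓘(ℝ, ℝ) ∞ (radius (M := M)) :=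
  contMDiff_subtype_val.comp contMDiff_snd

variable (I) in
theorem mvfderiv_radius (p : Cone M) : mvfderiv (coneModel I) radius p = dr I p := by
  have h1 : MDifferentiableAt 𝓘(ℝ, ℝ) 𝓘(ℝ, ℝ) (Subtype.val : posReals → ℝ) p.2 :=
    ((contMDiff_subtype_val (I := 𝓘(ℝ, ℝ)) (n := 1)) p.2).mdifferentiableAt (by simp)
  have h2 := mfderiv_comp p h1 (mdifferentiableAt_snd (I := I))
  rw [mfderiv_val_posReals, mfderiv_snd] at h2
  ext v
  exact congrArg (fun A ↦ A v) h2

theorem lift_add_euler (p : Cone M) (u : TangentSpace (coneModel I) p) :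
    lift I p (dproj I p u) + ((radius p)⁻¹ * dr I p u) • euler I p = u := by
  have : (radius p)⁻¹ * u.2 * radius p = u.2 := by field_simp [(radius_pos p).ne']
  apply Prod.ext
  · change u.1 + ((radius p)⁻¹ * u.2) • (0 : E) = u.1
    simp
  · change (0 : ℝ) + ((radius p)⁻¹ * u.2) * radius p = u.2
    rw [this, zero_add]

variable [IsManifold I ∞ M]

theorem contMDiffAt_dproj {n : ℕ∞ω} {W : VField (coneModel I) (Cone M)} {p : Cone M} (hn : n ≤ ∞)
    (hW : ContMDiffAt (coneModel I) (coneModel I).tangent n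
      (fun q ↦ (W q : TangentBundle (coneModel I) (Cone M))) p) :
    ContMDiffAt (coneModel I) I.tangent n
      (fun q ↦ (⟨q.1, dproj I q (W q)⟩ : TangentBundle I M)) p := by
  have h1 := contMDiff_fst.comp (contMDiff_equivTangentBundleProd (I := I) (I' := 𝓘(ℝ, ℝ)) (M := M)
    (M' := posReals) (n := ∞))
  exact ((h1 _).of_le hn).comp p hW

theorem contMDiffAt_dr {n : ℕ∞ω} {W : VField (coneModel I) (Cone M)} {p : Cone M} (hn : n ≤ ∞)
    (hW : ContMDiffAt (coneModel I) (coneModel I).tangent n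
      (fun q ↦ (W q : TangentBundle (coneModel I) (Cone M))) p) :
    ContMDiffAt (coneModel I) 𝓘(ℝ, ℝ) n (fun q ↦ dr I q (W q)) p := by
  have h1 := (contMDiff_snd_tangentBundle_modelSpace ℝ 𝓘(ℝ, ℝ)).comp
    ((contMDiff_radius (I := I) (M := M)).contMDiff_tangentMap (m := ∞) (by decide))
  have := ((h1 _).of_le hn).comp p hW
  simp only [← mvfderiv_radius]
  exact this

theorem contMDiffAt_lift {n : ℕ∞ω} {A : Π q : Cone M, TangentSpace I q.1} {p : Cone M} (hn : n ≤ ∞)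
    (hA : ContMDiffAt (coneModel I) I.tangent n (fun q ↦ (⟨q.1, A q⟩ : TangentBundle I M)) p) :
    ContMDiffAt (coneModel I) (coneModel I).tangent n
      (fun q ↦ (lift I q (A q) : TangentBundle (coneModel I) (Cone M))) p := by
  have h1 : ContMDiffAt (coneModel I) 𝓘(ℝ, ℝ).tangent n
      (fun q ↦ (⟨q.2, (0 : ℝ)⟩ : TangentBundle 𝓘(ℝ, ℝ) posReals)) p :=
    ((contMDiff_zeroSection ℝ (TangentSpace 𝓘(ℝ, ℝ) : posReals → Type)).comp
      (contMDiff_snd (I := I) (M := M)) p).of_le hn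
  have h2 := contMDiff_equivTangentBundleProd_symm (I := I) (I' := 𝓘(ℝ, ℝ)) (M := M)
    (M' := posReals) (n := ∞)
  exact ((h2 _).of_le hn).comp p (hA.prodMk h1)

theorem isSmoothVField_euler : IsSmoothVField (coneModel I) (euler I (M := M)) := by
  have h1 : ContMDiff (coneModel I) I.tangent ∞
      (fun q : Cone M ↦ (⟨q.1, (0 : E)⟩ : TangentBundle I M)) :=
    ((contMDiff_zeroSection ℝ (TangentSpace I : M → Type _)).comp contMDiff_fst)
  have h2 := contMDiff_equivTangentBundleProd_symm (I := I) (I' := 𝓘(ℝ, ℝ)) (M := M)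
    (M' := posReals) (n := ∞)
  have h3 : IsSmoothVField (coneModel I) (fun q : Cone M ↦ ((0, 1) : E × ℝ)) :=
    h2.comp (h1.prodMk (isSmoothVField_unitField.comp contMDiff_snd))
  refine ContMDiff.congr (ContMDiff.smul_section contMDiff_radius h3) fun q ↦ ?_
  congr 1
  exact Prod.ext (smul_zero (A := E) (radius q)).symm (mul_one (radius q)).symm

end ConeFields

section ConeBrackets

variable {E : Type*} [NormedAddCommGroup E] [NormedSpace ℝ E]
  {H : Type*} [TopologicalSpace H] {I : ModelWithCorners ℝ E H}
  {M : Type*} [TopologicalSpace M] [ChartedSpace H M] [IsManifold I ∞ M]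
  {F : Type*} [NormedAddCommGroup F] [NormedSpace ℝ F]

theorem mdifferentiableAt_mvfderiv_apply {f : M → F} {X : VField I M} {x : M}
    (hf : ContMDiffAt I 𝓘(ℝ, F) ∞ f x)
    (hX : MDifferentiableAt I I.tangent (fun x ↦ (X x : TangentBundle I M)) x) :
    MDifferentiableAt I 𝓘(ℝ, F) (fun y ↦ mvfderiv I f y (X y)) x := by
  have : IsManifold I 2 M := .of_le (n := ∞) (by decide)
  obtain ⟨u, hu, hfu⟩ := (contMDiffAt_iff_contMDiffOn_nhds (n := 2) (by decide)).1
    (hf.of_le (m := 2) (by decide))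
  obtain ⟨v, hvu, hv, hxv⟩ := mem_nhds_iff.1 hu
  have h1 := (hfu.mono hvu).contMDiffOn_tangentMapWithin (m := 1) (by norm_num) hv.uniqueMDiffOn
  have h2 : MDifferentiableAt I.tangent 𝓘(ℝ, F).tangent (tangentMap I 𝓘(ℝ, F) f)
      (⟨x, X x⟩ : TangentBundle I M) := by
    have hmem : TotalSpace.proj ⁻¹' v ∈ 𝓝 (⟨x, X x⟩ : TangentBundle I M) :=
      (hv.preimage (FiberBundle.continuous_proj E (TangentSpace I))).mem_nhds hxv
    refine (((h1 _ hxv).contMDiffAt hmem).mdifferentiableAt one_ne_zero).congr_of_eventuallyEq ?_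
    filter_upwards [hmem] with w hw
    exact (tangentMapWithin_eq_tangentMap (hv.uniqueMDiffOn _ hw)
      (((hfu.mono hvu).contMDiffAt (hv.mem_nhds hw)).mdifferentiableAt (by simp))).symm
  exact (((contMDiff_snd_tangentBundle_modelSpace F 𝓘(ℝ, F) (n := 1)) _).mdifferentiableAt
    one_ne_zero).comp x (h2.comp x hX)

omit [IsManifold I ∞ M] in
theorem mvfderiv_comp_fst {f : M → F} {p : Cone M} (hf : MDifferentiableAt I 𝓘(ℝ, F) f p.1)
    (u : TangentSpace (coneModel I) p) :
    mvfderiv (coneModel I) (fun q : Cone M ↦ f q.1) p u = mvfderiv I f p.1 (dproj I p u) := by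
  have h := mfderiv_comp p hf (mdifferentiableAt_fst (I := I) (I' := 𝓘(ℝ, ℝ)))
  rw [mfderiv_fst] at h
  exact congrArg (fun L ↦ L u) h

/-- The Lie bracket of projectable vector fields on the cone projects to the Lie bracket. -/
theorem dproj_mlieBracket [CompleteSpace E] {V W : VField (coneModel I) (Cone M)} {A B : VField I M}
    {p : Cone M} (hV : IsSmoothVField (coneModel I) V) (hW : IsSmoothVField (coneModel I) W)
    (hA : IsSmoothVField I A) (hB : IsSmoothVField I B)
    (hVA : ∀ q, dproj I q (V q) = A q.1) (hWB : ∀ q, dproj I q (W q) = B q.1) :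
    dproj I p (mlieBracket (coneModel I) V W p) = mlieBracket I A B p.1 := by
  have hφ : ContMDiffAt I 𝓘(ℝ, E) ∞ (extChartAt I p.1) p.1 := contMDiffAt_extChartAt
  have hf : ContMDiffAt (coneModel I) 𝓘(ℝ, E) ∞ (extChartAt I p.1 ∘ Prod.fst : Cone M → E) p :=
    hφ.comp p contMDiffAt_fst
  have hev : ∀ᶠ q : Cone M in 𝓝 p, MDifferentiableAt I 𝓘(ℝ, E) (extChartAt I p.1) q.1 := by
    filter_upwards [continuous_fst.continuousAt.preimage_mem_nhds
      (extChartAt_source_mem_nhds (I := I) p.1)] with q hq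
    exact mdifferentiableAt_extChartAt (by simpa using hq)
  have key {X Y : VField (coneModel I) (Cone M)} {C D : VField I M} (hD : IsSmoothVField I D)
      (hX : ∀ q, dproj I q (X q) = C q.1) (hY : ∀ q, dproj I q (Y q) = D q.1) :
      mvfderiv (coneModel I) (fun q ↦ mvfderiv (coneModel I) (extChartAt I p.1 ∘ Prod.fst) q (Y q))
        p (X p) = mvfderiv I (fun x ↦ mvfderiv I (extChartAt I p.1) x (D x)) p.1 (C p.1) := by
    have : (fun q : Cone M ↦ mvfderiv (coneModel I) (extChartAt I p.1 ∘ Prod.fst) q (Y q))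
        =ᶠ[𝓝 p] (fun x ↦ mvfderiv I (extChartAt I p.1) x (D x)) ∘ Prod.fst := by
      filter_upwards [hev] with q hq
      exact (mvfderiv_comp_fst hq _).trans (by rw [hY, Function.comp_apply])
    exact (congrArg (fun L : TangentSpace (coneModel I) p →L[ℝ] E ↦ L (X p))
      this.mfderiv_eq).trans <| (mvfderiv_comp_fst (mdifferentiableAt_mvfderiv_apply hφ (hD.mdifferentiableAt _)) _).trans
      (by rw [hX])
  have hs {X : VField (coneModel I) (Cone M)} (hX : IsSmoothVField (coneModel I) X) :=
    mdifferentiableAt_mvfderiv_apply hf (hX.mdifferentiableAt p)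
  have hs' {X : VField I M} (hX : IsSmoothVField I X) :=
    mdifferentiableAt_mvfderiv_apply hφ (hX.mdifferentiableAt p.1)
  have h1 := mvfderiv_mlieBracket hf (hV.mdifferentiableAt p) (hW.mdifferentiableAt p) (hs hV)
    (hs hW)
  have h2 := mvfderiv_mlieBracket hφ (hA.mdifferentiableAt p.1) (hB.mdifferentiableAt p.1)
    (hs' hA) (hs' hB)
  rw [key hB hVA hWB, key hA hWB hVA, ← h2] at h1
  exact (isInvertible_chartDeriv (mem_extChartAt_source p.1)).injective
    ((mvfderiv_comp_fst hev.self_of_nhds _).symm.trans h1)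

theorem dr_mlieBracket [CompleteSpace E] {V W : VField (coneModel I) (Cone M)}
    (hV : IsSmoothVField (coneModel I) V) (hW : IsSmoothVField (coneModel I) W) (p : Cone M) :
    dr I p (mlieBracket (coneModel I) V W p) =
      mvfderiv (coneModel I) (fun q ↦ dr I q (W q)) p (V p) -
        mvfderiv (coneModel I) (fun q ↦ dr I q (V q)) p (W p) := by
  simp only [← mvfderiv_radius]
  exact mvfderiv_mlieBracket_of_smooth contMDiff_radius hV hW p

/-- The vector field on the cone invariant under dilations, with components `A` and `h Ψ`. -/
def coneField (A : VField I M) (h : M → ℝ) : VField (coneModel I) (Cone M) :=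
  fun p ↦ lift I p (A p.1) + h p.1 • euler I p

omit [IsManifold I ∞ M] in
theorem dproj_coneField (A : VField I M) (h : M → ℝ) (p : Cone M) :
    dproj I p (coneField A h p) = A p.1 := by
  have (a : E) (c : ℝ) : a + c • (0 : E) = a := by rw [smul_zero, add_zero]
  exact this _ _

omit [IsManifold I ∞ M] in
theorem dr_coneField (A : VField I M) (h : M → ℝ) (p : Cone M) :
    dr I p (coneField A h p) = radius p * h p.1 := by
  change (0 : ℝ) + h p.1 * radius p = radius p * h p.1
  ring

omit [IsManifold I ∞ M] in
theorem eq_of_dproj_eq_of_dr_eq {p : Cone M} {u v : TangentSpace (coneModel I) p}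
    (h1 : dproj I p u = dproj I p v) (h2 : dr I p u = dr I p v) : u = v :=
  Prod.ext h1 h2

theorem isSmoothVField_coneField {A : VField I M} {h : M → ℝ} (hA : IsSmoothVField I A)
    (hh : ContMDiff I 𝓘(ℝ, ℝ) ∞ h) : IsSmoothVField (coneModel I) (coneField A h) :=
  ContMDiff.add_section (fun p ↦ contMDiffAt_lift le_rfl (hA.comp contMDiff_fst p))
    (ContMDiff.smul_section (hh.comp contMDiff_fst) isSmoothVField_euler)

theorem mlieBracket_coneField [CompleteSpace E] {A B : VField I M} {h k : M → ℝ}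
    (hA : IsSmoothVField I A) (hB : IsSmoothVField I B) (hh : ContMDiff I 𝓘(ℝ, ℝ) ∞ h)
    (hk : ContMDiff I 𝓘(ℝ, ℝ) ∞ k) :
    mlieBracket (coneModel I) (coneField A h) (coneField B k) =
      coneField (mlieBracket I A B) (fun x ↦ mvfderiv I k x (A x) - mvfderiv I h x (B x)) := by
  have hV := isSmoothVField_coneField hA hh
  have hW := isSmoothVField_coneField hB hk
  have hder {A : VField I M} {h k : M → ℝ} (hk : ContMDiff I 𝓘(ℝ, ℝ) ∞ k) (p : Cone M) :
      mvfderiv (coneModel I) (fun q ↦ radius q * k q.1) p (coneField A h p) =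
        radius p * (h p.1 * k p.1 + mvfderiv I k p.1 (A p.1)) := by
    have hk1 : MDifferentiableAt I 𝓘(ℝ, ℝ) k p.1 := (hk p.1).mdifferentiableAt (by simp)
    have hk' : MDifferentiableAt (coneModel I) 𝓘(ℝ, ℝ) (fun q : Cone M ↦ k q.1) p :=
      hk1.comp p mdifferentiableAt_fst
    have hr : MDifferentiableAt (coneModel I) 𝓘(ℝ, ℝ) (radius : Cone M → ℝ) p :=
      (contMDiff_radius p).mdifferentiableAt (by simp)
    rw [mvfderiv_fun_mul hr hk', add_apply, smul_apply, smul_apply, mvfderiv_comp_fst hk1,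
      dproj_coneField, mvfderiv_radius, dr_coneField, smul_eq_mul, smul_eq_mul]
    ring
  funext p
  refine eq_of_dproj_eq_of_dr_eq ?_ ?_
  · rw [dproj_mlieBracket hV hW hA hB (dproj_coneField A h) (dproj_coneField B k), dproj_coneField]
  · rw [dr_mlieBracket hV hW, dr_coneField]
    simp only [dr_coneField]
    rw [hder hk, hder hh]
    ring

/-- Every tangent vector of the cone is the value of a smooth dilation invariant vector field. -/
theorem exists_coneField_eq [FiniteDimensional ℝ E] [T2Space M] (p : Cone M)
    (u : TangentSpace (coneModel I) p) :
    ∃ (A : VField I M) (c : ℝ), IsSmoothVField I A ∧ coneField A (fun _ ↦ c) p = u := by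
  obtain ⟨s, hs, hA⟩ := FiberBundle.exists_contMDiffOn_extend (k := ∞) I E (dproj I p u)
  obtain ⟨v, hvs, hv, hpv⟩ := mem_nhds_iff.1 hs
  obtain ⟨f, -, hf⟩ := (SmoothBumpFunction.nhds_basis_tsupport (I := I) p.1).mem_iff.1 (hv.mem_nhds hpv)
  refine ⟨(f : M → ℝ) • FiberBundle.extend E (dproj I p u), (radius p)⁻¹ * dr I p u,
    ContMDiffOn.smul_section_of_tsupport f.contMDiff.contMDiffOn hv hf (hA.mono hvs), ?_⟩
  rw [coneField, Pi.smul_apply', FiberBundle.extend_apply_self, f.eq_one, one_smul,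
    lift_add_euler]

end ConeBrackets

namespace MetricContactStructure

variable {E : Type*} [NormedAddCommGroup E] [NormedSpace ℝ E]
  {H : Type*} [TopologicalSpace H] {I : ModelWithCorners ℝ E H}
  {M : Type*} [TopologicalSpace M] [ChartedSpace H M] [IsManifold I ∞ M]
  (S : MetricContactStructure I M)

theorem coneOneForm_apply (p : Cone M) (u : TangentSpace (coneModel I) p) :
    coneOneForm I S p u = radius p ^ 2 * S.η p.1 (dproj I p u) :=
  rfl

theorem coneMetric_apply (p : Cone M) (u v : TangentSpace (coneModel I) p) :
    coneMetric I S p u v =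
      dr I p u * dr I p v + radius p ^ 2 * S.g p.1 (dproj I p u) (dproj I p v) :=
  rfl

theorem coneJ_apply (p : Cone M) (u : TangentSpace (coneModel I) p) :
    coneJ I S p u = lift I p (S.Φ p.1 (dproj I p u)) - S.η p.1 (dproj I p u) • euler I p +
      ((radius p)⁻¹ * dr I p u) • coneReeb I S p :=
  rfl

theorem dproj_coneJ (p : Cone M) (u : TangentSpace (coneModel I) p) :
    dproj I p (coneJ I S p u) =
      S.Φ p.1 (dproj I p u) + ((radius p)⁻¹ * dr I p u) • S.ξ p.1 := by
  have (a b : E) (c : ℝ) : a - c • (0 : E) + b = a + b := by rw [smul_zero, sub_zero]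
  exact this _ _ _

theorem dr_coneJ (p : Cone M) (u : TangentSpace (coneModel I) p) :
    dr I p (coneJ I S p u) = -(radius p * S.η p.1 (dproj I p u)) := by
  have (a b c : ℝ) : 0 - a * b + c * 0 = -(b * a) := by ring
  exact this _ _ _

theorem coneJ_coneField (A : VField I M) (h : M → ℝ) :
    (fun p ↦ coneJ I S p (coneField A h p)) =
      coneField (fun x ↦ S.Φ x (A x) + h x • S.ξ x) (fun x ↦ -S.η x (A x)) := by
  funext p
  have hr := (radius_pos p).ne'
  refine eq_of_dproj_eq_of_dr_eq ?_ ?_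
  · rw [dproj_coneJ, dproj_coneField, dproj_coneField, dr_coneField, inv_mul_cancel_left₀ hr]
  · rw [dr_coneJ, dproj_coneField, dr_coneField]; ring

theorem coneReeb_eq_coneField : coneReeb I S = coneField S.ξ (fun _ ↦ 0) := by
  funext p
  rw [coneField, zero_smul, add_zero, coneReeb]

omit [IsManifold I ∞ M] in
theorem _root_.AlmostKahlerCone.euler_eq_coneField :
    euler I (M := M) = coneField (fun _ ↦ 0) (fun _ ↦ 1) := by
  funext p
  rw [coneField, one_smul, map_zero, zero_add]

theorem isSmoothCovField_coneOneForm [FiniteDimensional ℝ E] :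
    IsSmoothCovField (coneModel I) (coneOneForm I S) := by
  refine isSmoothCovField_of_forall fun p W hW ↦ ?_
  have h1 := ((S.contact.smooth.comp contMDiff_fst) p).clm_bundle_apply (F₁ := E)
    (E₁ := TangentSpace I) (F₂ := ℝ) (E₂ := Bundle.Trivial M ℝ) (contMDiffAt_dproj le_rfl hW)
  have h2 := (contMDiffAt_totalSpace.1 h1).2
  exact ((contMDiff_radius p).pow 2).mul (by simpa using h2)

theorem isSmoothEndField_coneJ [FiniteDimensional ℝ E] :
    IsSmoothEndField (coneModel I) (coneJ I S) := by
  refine isSmoothEndField_of_forall fun p W hW ↦ ?_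
  have h0 := contMDiffAt_dproj le_rfl hW
  have h1 := ((S.contact.smooth.comp contMDiff_fst) p).clm_bundle_apply (F₁ := E)
    (E₁ := TangentSpace I) (F₂ := ℝ) (E₂ := Bundle.Trivial M ℝ) h0
  have h2 : ContMDiffAt (coneModel I) 𝓘(ℝ, ℝ) ∞ (fun q ↦ S.η q.1 (dproj I q (W q))) p := by
    simpa using (contMDiffAt_totalSpace.1 h1).2
  have h3 := ((S.smooth_Φ.comp contMDiff_fst) p).clm_bundle_apply (F₁ := E)
    (E₁ := TangentSpace I) (F₂ := E) (E₂ := TangentSpace I) h0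
  have hr := (contMDiff_radius (I := I) p).inv₀ (radius_pos p).ne'
  simp only [coneJ_apply]
  exact ((contMDiffAt_lift le_rfl h3).sub_section (h2.smul_section (isSmoothVField_euler p)))
    |>.add_section ((hr.mul (contMDiffAt_dr le_rfl hW)).smul_section
      (contMDiffAt_lift le_rfl ((S.smooth_ξ.comp contMDiff_fst) p)))

theorem isSmoothBilinField_coneMetric [FiniteDimensional ℝ E] :
    IsSmoothBilinField (coneModel I) (coneMetric I S) := by
  refine isSmoothBilinField_of_forall fun p V W hV hW ↦ ?_
  have h1 := ((S.riemannian.smooth.comp contMDiff_fst) p).clm_bundle_apply (F₁ := E)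
    (E₁ := TangentSpace I) (F₂ := E →L[ℝ] ℝ) (E₂ := fun x : M ↦ (TangentSpace I x →L[ℝ] ℝ))
    (contMDiffAt_dproj le_rfl hV)
  have h2 := h1.clm_bundle_apply (F₁ := E) (E₁ := TangentSpace I) (F₂ := ℝ)
    (E₂ := Bundle.Trivial M ℝ) (contMDiffAt_dproj le_rfl hW)
  have h3 : ContMDiffAt (coneModel I) 𝓘(ℝ, ℝ) ∞
      (fun q ↦ S.g q.1 (dproj I q (V q)) (dproj I q (W q))) p := by
    simpa using (contMDiffAt_totalSpace.1 h2).2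
  exact ((contMDiffAt_dr le_rfl hV).mul (contMDiffAt_dr le_rfl hW)).add
    (((contMDiff_radius p).pow 2).mul h3)

variable [FiniteDimensional ℝ E] [T2Space M]

/-- `d(r² η) = r² dη + 2 r dr ∧ η`. -/
theorem coneForm_apply (p : Cone M) (u v : TangentSpace (coneModel I) p) :
    coneForm I S p ![u, v] =
      radius p ^ 2 * extDer I (CovField.toForm I S.η) p.1 ![dproj I p u, dproj I p v] +
        radius p * (dr I p u * S.η p.1 (dproj I p v) - dr I p v * S.η p.1 (dproj I p u)) := by
  have : CompleteSpace E := FiniteDimensional.complete ℝ E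
  obtain ⟨A, h, hA, rfl⟩ := exists_coneField_eq p u
  obtain ⟨B, k, hB, rfl⟩ := exists_coneField_eq p v
  have hV := isSmoothVField_coneField hA (contMDiff_const (c := h))
  have hW := isSmoothVField_coneField hB (contMDiff_const (c := k))
  have hder {A B : VField I M} (h : ℝ) (hB : IsSmoothVField I B) :
      mvfderiv (coneModel I) (fun q ↦ radius q ^ 2 * S.η q.1 (B q.1)) p
        (coneField A (fun _ ↦ h) p) = radius p ^ 2 * (2 * h * S.η p.1 (B p.1) +
          mvfderiv I (fun x ↦ S.η x (B x)) p.1 (A p.1)) := by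
    have hk1 : MDifferentiableAt I 𝓘(ℝ, ℝ) (fun x ↦ S.η x (B x)) p.1 :=
      (S.contact.smooth.apply hB p.1).mdifferentiableAt (by simp)
    have hk' : MDifferentiableAt (coneModel I) 𝓘(ℝ, ℝ) (fun q : Cone M ↦ S.η q.1 (B q.1)) p :=
      hk1.comp p mdifferentiableAt_fst
    have hr : MDifferentiableAt (coneModel I) 𝓘(ℝ, ℝ) (radius : Cone M → ℝ) p :=
      (contMDiff_radius p).mdifferentiableAt (by simp)
    have hr' : MDifferentiableAt (coneModel I) 𝓘(ℝ, ℝ)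
        (fun q : Cone M ↦ radius q * S.η q.1 (B q.1)) p := hr.mul hk'
    have e := mvfderiv_comp_fst hk1 (coneField A (fun _ ↦ h) p)
    simp only [sq, mul_assoc]
    rw [mvfderiv_fun_mul hr hr', mvfderiv_fun_mul hr hk', add_apply, smul_apply, smul_apply,
      add_apply, smul_apply, smul_apply, e,
      dproj_coneField, mvfderiv_radius, dr_coneField]
    simp only [smul_eq_mul]
    ring
  rw [coneForm, extDer_toForm_apply S.isSmoothCovField_coneOneForm (hV.mdifferentiableAt p)
    (hW.mdifferentiableAt p), mlieBracket_coneField hA hB contMDiff_const contMDiff_const]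
  simp only [coneOneForm_apply, dproj_coneField, dr_coneField]
  rw [hder h hB, hder k hA, extDer_toForm_apply S.contact.smooth (hA.mdifferentiableAt p.1)
    (hB.mdifferentiableAt p.1)]
  ring

theorem coneMetric_eq_coneForm (p : Cone M) (u v : TangentSpace (coneModel I) p) :
    coneMetric I S p u v = coneForm I S p ![u, coneJ I S p v] := by
  have hr := (radius_pos p).ne'
  rw [coneForm_apply, coneMetric_apply, dproj_coneJ, dr_coneJ, map_add, map_smul, S.η_Φ, S.η_ξ,
    pair_add_right, pair_smul_right, pair_swap _ _ (S.ξ p.1), S.dη_ξ, S.g_eq, smul_eq_mul]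
  field_simp
  ring

omit [FiniteDimensional ℝ E] [T2Space M] in
theorem coneMetric_pos (p : Cone M) (u : TangentSpace (coneModel I) p) (hu : u ≠ 0) :
    0 < coneMetric I S p u u := by
  have hr := radius_pos p
  rw [coneMetric_apply]
  by_cases h : dproj I p u = 0
  · have h2 : dr I p u ≠ 0 := fun h2 ↦ hu (eq_of_dproj_eq_of_dr_eq (by rw [h, map_zero])
      (by rw [h2, map_zero]))
    rw [h, map_zero, mul_zero, add_zero]
    exact mul_self_pos.2 h2
  · have := S.riemannian.pos p.1 _ h
    exact add_pos_of_nonneg_of_pos (mul_self_nonneg _) (by positivity)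

/-- The cone of a metric contact structure is almost Kähler. -/
theorem isAlmostKahler_cone [I.Boundaryless] :
    IsAlmostKahler (coneModel I) (coneForm I S) (coneMetric I S) (coneJ I S) where
  symplectic.smooth X hX := by
    have := contMDiff_extDer_toForm S.isSmoothCovField_coneOneForm (hX 0) (hX 1)
    refine this.congr fun p ↦ ?_
    rw [coneForm]
    congr 1
    ext i
    fin_cases i <;> rfl
  symplectic.closed := extDer_extDer_toForm S.isSmoothCovField_coneOneForm
  symplectic.nondegenerate p u h := by
    by_contra hu
    have := S.coneMetric_pos p u hu
    rw [coneMetric_eq_coneForm, h] at this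
    exact this.false
  riemannian.smooth := S.isSmoothBilinField_coneMetric
  riemannian.symm p u v := by
    rw [coneMetric_apply, coneMetric_apply, S.riemannian.symm, mul_comm (dr I p u)]
  riemannian.pos := S.coneMetric_pos
  almostComplex.smooth := S.isSmoothEndField_coneJ
  almostComplex.sq p u := by
    have hr := (radius_pos p).ne'
    refine eq_of_dproj_eq_of_dr_eq ?_ ?_
    · rw [dproj_coneJ, dproj_coneJ, dr_coneJ, map_add, map_smul, S.Φ_ξ, smul_zero, add_zero,
        S.Φ_sq, mul_neg, inv_mul_cancel_left₀ hr, map_neg, neg_smul, add_neg_cancel_right]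
    · rw [dr_coneJ, dproj_coneJ, map_add, S.η_Φ, map_smul, S.η_ξ, zero_add, smul_eq_mul, mul_one,
        mul_inv_cancel_left₀ hr, map_neg]
  compatible := S.coneMetric_eq_coneForm

end MetricContactStructure

section InfinitesimalAutomorphisms

variable {E : Type*} [NormedAddCommGroup E] [NormedSpace ℝ E]
  {H : Type*} [TopologicalSpace H] {I : ModelWithCorners ℝ E H}
  {M : Type*} [TopologicalSpace M] [ChartedSpace H M] [IsManifold I ∞ M]

/-- The Lie derivative of a smooth field of endomorphisms is tensorial. -/
theorem tensorialAt_mlieBracket_sub [FiniteDimensional ℝ E] {J : EndField I M}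
    (hJ : IsSmoothEndField I J) (V : VField I M) (x : M) :
    TensorialAt I E (fun W : VField I M ↦
      mlieBracket I V (fun y ↦ J y (W y)) x - J x (mlieBracket I V W x)) x where
  smul {f W} hf hW := by
    have h1 : (fun y ↦ J y ((f • W) y)) = f • fun y ↦ J y (W y) := by
      funext y
      exact map_smul (J y) (f y) (W y)
    simp only [h1]
    rw [mlieBracket_smul_right hf (hJ.mdifferentiableAt_apply hW), mlieBracket_smul_right hf hW,
      map_add, map_smul, map_smul, add_sub_add_left_eq_sub, smul_sub]
  add {W W'} hW hW' := by
    have h1 : (fun y ↦ J y ((W + W') y)) = (fun y ↦ J y (W y)) + fun y ↦ J y (W' y) := by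
      funext y
      exact map_add (J y) (W y) (W' y)
    simp only [h1]
    rw [mlieBracket_add_right (hJ.mdifferentiableAt_apply hW) (hJ.mdifferentiableAt_apply hW'),
      mlieBracket_add_right hW hW', map_add, add_sub_add_comm]

theorem mlieBracket_neg_left [CompleteSpace E] {V W : VField I M} (hV : IsSmoothVField I V) :
    mlieBracket I (-V) W = -mlieBracket I V W := by
  funext x
  rw [← neg_one_smul ℝ V, mlieBracket_const_smul_left (hV.mdifferentiableAt x), neg_one_smul,
    Pi.neg_apply]

end InfinitesimalAutomorphisms

namespace MetricContactStructure

variable {E : Type*} [NormedAddCommGroup E] [NormedSpace ℝ E] [FiniteDimensional ℝ E]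
  {H : Type*} [TopologicalSpace H] {I : ModelWithCorners ℝ E H}
  {M : Type*} [TopologicalSpace M] [ChartedSpace H M] [IsManifold I ∞ M] [T2Space M]
  (S : MetricContactStructure I M)

/-- If `A` commutes with `ξ` and preserves `η` and `Φ` then `A + c Ψ` preserves `J`. -/
theorem mlieBracket_coneField_coneJ {A : VField I M} (hA : IsSmoothVField I A) (c : ℝ)
    (hξ : ∀ x, mlieBracket I A S.ξ x = 0)
    (hη : ∀ B : VField I M, IsSmoothVField I B → ∀ x,
      mvfderiv I (fun y ↦ S.η y (B y)) x (A x) = S.η x (mlieBracket I A B x))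
    (hΦ : ∀ B : VField I M, IsSmoothVField I B → ∀ x,
      mlieBracket I A (fun y ↦ S.Φ y (B y)) x = S.Φ x (mlieBracket I A B x))
    {W : VField (coneModel I) (Cone M)} (hW : IsSmoothVField (coneModel I) W) (p : Cone M) :
    mlieBracket (coneModel I) (coneField A fun _ ↦ c) (fun q ↦ coneJ I S q (W q)) p =
      coneJ I S p (mlieBracket (coneModel I) (coneField A fun _ ↦ c) W p) := by
  have : CompleteSpace E := FiniteDimensional.complete ℝ E
  have hT := tensorialAt_mlieBracket_sub S.isSmoothEndField_coneJ (coneField A fun _ ↦ c) p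
  obtain ⟨B, k, hB, hBW⟩ := exists_coneField_eq p (W p)
  have hBk := isSmoothVField_coneField hB (contMDiff_const (c := k))
  have hkξ : IsSmoothVField I (fun x ↦ k • S.ξ x) := S.smooth_ξ.const_smul_section
  have hBξ : IsSmoothVField I (fun x ↦ S.Φ x (B x) + k • S.ξ x) :=
    (S.smooth_Φ.apply hB).add_section hkξ
  have hηB := S.contact.smooth.apply hB
  refine sub_eq_zero.1 ((hT.pointwise (hW.mdifferentiableAt p) (hBk.mdifferentiableAt p)
    hBW.symm).trans (sub_eq_zero.2 ?_))
  have e1 (x : M) : mlieBracket I A (fun x ↦ S.Φ x (B x) + k • S.ξ x) x =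
      S.Φ x (mlieBracket I A B x) := by
    have h1 := mlieBracket_add_right (V := A) ((S.smooth_Φ.apply hB).mdifferentiableAt x)
      (hkξ.mdifferentiableAt x)
    have h2 := mlieBracket_const_smul_right (V := A) (c := k) (S.smooth_ξ.mdifferentiableAt x)
    refine h1.trans ?_
    refine (congrArg _ h2).trans ?_
    rw [hξ, smul_zero, add_zero, hΦ B hB]
  have e2 (x : M) : mvfderiv I (fun x ↦ -S.η x (B x)) x (A x) = -S.η x (mlieBracket I A B x) := by
    rw [← hη B hB]
    have := mvfderiv_neg (I := I) (g := fun x ↦ S.η x (B x)) (x := x)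
    exact congrArg (fun L : TangentSpace I x →L[ℝ] ℝ ↦ L (A x)) this
  rw [coneJ_coneField, mlieBracket_coneField hA hBξ contMDiff_const hηB.neg,
    mlieBracket_coneField hA hB contMDiff_const contMDiff_const]
  refine Eq.trans ?_ (congrFun (S.coneJ_coneField _ _) p).symm
  congr 1
  · funext x
    rw [e1, mvfderiv_const, mvfderiv_const, zero_apply, zero_apply, sub_self, zero_smul, add_zero]
  · funext x
    rw [e2, mvfderiv_const, zero_apply, sub_zero]

theorem isKContact_iff_isPseudoHolomorphic : S.IsKContact ↔
    IsPseudoHolomorphic (coneModel I) (coneJ I S) (eulerSubIReeb I S) := by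
  have : CompleteSpace E := FiniteDimensional.complete ℝ E
  have hreeb : IsSmoothVField (coneModel I) (coneReeb I S) := by
    rw [coneReeb_eq_coneField]
    exact isSmoothVField_coneField S.smooth_ξ contMDiff_const
  rw [isKContact_iff]
  constructor
  · intro h W hW
    have hzero : IsSmoothVField I (fun x : M ↦ (0 : TangentSpace I x)) :=
      contMDiff_zeroSection ℝ (TangentSpace I : M → Type _)
    have hz (B : VField I M) (x : M) : mlieBracket I (fun _ ↦ 0) B x = 0 :=
      congrFun (mlieBracket_zero_left (I := I) (W := B)) x
    have h1 {X : VField (coneModel I) (Cone M)} (hX : IsSmoothVField (coneModel I) X)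
        (p : Cone M) : mlieBracket (coneModel I) (euler I) (fun q ↦ coneJ I S q (X q)) p =
          coneJ I S p (mlieBracket (coneModel I) (euler I) X p) := by
      rw [euler_eq_coneField]
      refine S.mlieBracket_coneField_coneJ hzero 1 (hz _) (fun B hB x ↦ ?_) (fun B hB x ↦ ?_) hX p
      · rw [hz, map_zero, map_zero]
      · rw [hz, hz, map_zero]
    have h2 {X : VField (coneModel I) (Cone M)} (hX : IsSmoothVField (coneModel I) X)
        (p : Cone M) : mlieBracket (coneModel I) (coneReeb I S) (fun q ↦ coneJ I S q (X q)) p =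
          coneJ I S p (mlieBracket (coneModel I) (coneReeb I S) X p) := by
      rw [coneReeb_eq_coneField]
      exact S.mlieBracket_coneField_coneJ S.smooth_ξ 0
        (congrFun mlieBracket_self) (fun B hB x ↦ S.mvfderiv_η (hB.mdifferentiableAt x)) h hX p
    simp only [ComplexVField.bracket, ComplexVField.map, eulerSubIReeb,
      mlieBracket_neg_left hreeb, ComplexVField.mk.injEq]
    constructor <;> funext p <;>
      simp only [Pi.sub_apply, Pi.add_apply, Pi.neg_apply, h1 hW.1, h1 hW.2, h2 hW.1, h2 hW.2,
        map_sub, map_add, map_neg]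
  · intro h Z hZ x
    let p : Cone M := (x, ⟨1, one_pos (α := ℝ)⟩)
    have hZ' := isSmoothVField_coneField hZ (contMDiff_const (c := (0 : ℝ)))
    have hzero : IsSmoothVField (coneModel I)
        (0 : VField (coneModel I) (Cone M)) :=
      contMDiff_zeroSection ℝ (TangentSpace (coneModel I) : Cone M → Type _)
    have h1 := congrFun (congrArg ComplexVField.im (h ⟨coneField Z fun _ ↦ 0, 0⟩ ⟨hZ', hzero⟩)) p
    have hJ0 : (fun q ↦ coneJ I S q ((0 : VField (coneModel I) (Cone M)) q)) = 0 := by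
      funext q
      exact map_zero _
    have hΦZ : IsSmoothVField I (fun x ↦ S.Φ x (Z x) + (0 : ℝ) • S.ξ x) := by
      simp only [zero_smul, add_zero]
      exact S.smooth_Φ.apply hZ
    simp only [ComplexVField.bracket, ComplexVField.map, eulerSubIReeb, hJ0,
      mlieBracket_neg_left hreeb, mlieBracket_zero_right, zero_add, Pi.neg_apply, map_neg,
      neg_inj, coneJ_coneField] at h1
    rw [coneReeb_eq_coneField, mlieBracket_coneField S.smooth_ξ hΦZ contMDiff_const
      (S.contact.smooth.apply hZ).neg, mlieBracket_coneField S.smooth_ξ hZ contMDiff_const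
      contMDiff_const] at h1
    have h2 := congrArg (dproj I p) h1
    rw [dproj_coneField, dproj_coneJ, dproj_coneField, dr_coneField, mvfderiv_const,
      zero_apply, zero_apply, sub_self, mul_zero, mul_zero, zero_smul,
      add_zero] at h2
    simp only [zero_smul, add_zero] at h2
    exact h2

end MetricContactStructure

end

end AlmostKahlerCone

theorem proposition6p3 (n : ℕ) (M : Type*) [TopologicalSpace M]
    [ChartedSpace (EuclideanSpace ℝ (Fin (2 * n + 1))) M] [IsManifold (𝓡 (2 * n + 1)) ∞ M]
    [T2Space M] [CompactSpace M]
    (S : AlmostKahlerCone.MetricContactStructure (𝓡 (2 * n + 1)) M) :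
    S.IsKContact ↔
      (AlmostKahlerCone.IsAlmostKahler (AlmostKahlerCone.coneModel (𝓡 (2 * n + 1)))
          (AlmostKahlerCone.coneForm (𝓡 (2 * n + 1)) S)
          (AlmostKahlerCone.coneMetric (𝓡 (2 * n + 1)) S)
          (AlmostKahlerCone.coneJ (𝓡 (2 * n + 1)) S) ∧
        AlmostKahlerCone.IsPseudoHolomorphic (AlmostKahlerCone.coneModel (𝓡 (2 * n + 1)))
          (AlmostKahlerCone.coneJ (𝓡 (2 * n + 1)) S)
          (AlmostKahlerCone.eulerSubIReeb (𝓡 (2 * n + 1)) S)) := by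
  rw [S.isKContact_iff_isPseudoHolomorphic]
  exact (and_iff_right S.isAlmostKahler_cone).symm
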